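/- For even $n$ let $F_2\in\mathbb F_2^{n\times n/2}$ be the matrix that repeats every entry of a vector twice, let $A\in\mathbb F_2^{n\times n}$ be the accumulator matrix ($A_{ij}=1$ iff $i\ge j$), let $D\in\mathbb F_2^{n\times n}$ be the discrete derivative matrix ($D_{ij}=1$ iff $j=i$ or $j=i-1$), and let $M_\pi$ be the matrix of a permutation $\pi$ of $[n]$, $(M_\pi)_{ij}=1$ iff $\pi(i)=j$. For $m\ge 1$ and permutations $\pi_1,\dots,\pi_{2m}$ of $[n]$, the $R(AD)^m$ code and the $R(DA)^m$ code encode a message $x\in\mathbb F_2^{n/2}$ as $$ (DM_{\pi_{2m}}AM_{\pi_{2m-1}})\cdots(DM_{\pi_2}AM_{\pi_1})F_2x \qquad\text{and}\qquad (AM_{\pi_{2m}}DM_{\pi_{2m-1}})\cdots(AM_{\pi_2}DM_{\pi_1})F_2x, $$ respectively; each of the $m$ bracketed factors is one round (the vector after $0$ rounds is $F_2x$). The permutations are independent and uniformly random. Weight means the number of nonzero coordinates, and logarithms are to base $2$. Let $h(x)=-x\log x-(1-x)\log(1-x)$ be the binary entropy function and $$ f_A(\alpha,\beta)=\alpha-h(\beta)+(1-\alpha)\,h\!\left(\frac{\beta-\alpha/2}{1-\alpha}\right)\qquad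 (0\le\alpha\le\min\{2\beta,2(1-\beta)\}). $$ Define on $[0,1]$ the functions $$ \hat r^{(0)}(\gamma)=\tfrac12h(\gamma),\qquad \hat r^{(m)}(\gamma)=\max_{0\le\alpha\le\min\{2\gamma,2(1-\gamma)\}}\bigl\{\hat r^{(m-1)}(\alpha)+f_A(\alpha,\gamma)\bigr\}\quad(m\ge1), $$ and $\delta^{(m)}=\max\{\delta\in[0,1/2):\hat r^{(m)}(\gamma)=0\text{ for all }\gamma\in[0,\delta]\}$. **Theorem 4.7.** Let $\varepsilon>0$ and $m\ge1$, and let $h_n=\log^2n$. In the random $R(AD)^m$ code of block length $n$, the expected number of messages $x\in\mathbb F_2^{n/2}$ whose encoding has weight in $[h_n,n-h_n]$ after $m-1$ rounds and weight at most $(\delta^{(m)}-\varepsilon)n$ after $m$ rounds is $n^{-\Omega(\log n)}$: there is a constant $c>0$, depending only on $\varepsilon$ and $m$, such that this expectation is at most $n^{-c\log n}$ for all sufficiently large even $n$. The same holds for the random $R(DA)^m$ code, and for both codes with $A$ and $D$ replaced by their transposes. -/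

import Mathlib

open Filter
open scoped BigOperators Matrix

noncomputable section

namespace RepeatAccumulate

/-! ### The random codes -/

/-- The repetition matrix `F₂`: it repeats every bit of a message of length `n / 2` twice
(for even `n`; rows and columns are numbered from `0`). -/
def repetition (n : ℕ) : Matrix (Fin n) (Fin (n / 2)) (ZMod 2) :=
  Matrix.of fun i j => if (i : ℕ) / 2 = (j : ℕ) then 1 else 0

/-- The accumulator matrix `A` (prefix sums modulo 2). -/
def accumulator (n : ℕ) : Matrix (Fin n) (Fin n) (ZMod 2) :=
  Matrix.of fun i j => if j ≤ i then 1 else 0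

/-- The discrete derivative matrix `D`. -/
def derivative (n : ℕ) : Matrix (Fin n) (Fin n) (ZMod 2) :=
  Matrix.of fun i j => if i = j ∨ (i : ℕ) = (j : ℕ) + 1 then 1 else 0

/-- The permutations used in `m` rounds, two for each round. -/
abbrev RoundPerms (n m : ℕ) : Type := Fin m → Equiv.Perm (Fin n) × Equiv.Perm (Fin n)

/-- The generator matrix of the first `i` of the `m` rounds of the code `R(BC)^m` with the given
permutations: first repeat; then, in each round, permute, apply `B`, permute, apply `C`. -/
def generator {n m : ℕ} (B C : Matrix (Fin n) (Fin n) (ZMod 2)) (π : RoundPerms n m) :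
    (i : ℕ) → i ≤ m → Matrix (Fin n) (Fin (n / 2)) (ZMod 2)
  | 0, _ => repetition n
  | i + 1, hi =>
      C * (π ⟨i, hi⟩).2.permMatrix (ZMod 2) * (B * (π ⟨i, hi⟩).1.permMatrix (ZMod 2)) *
        generator B C π i (Nat.le_of_succ_le hi)

/-- The absolute Hamming weight of the encoding of the message `x` after the first `i` rounds. -/
def weightAfter {n m : ℕ} (B C : Matrix (Fin n) (Fin n) (ZMod 2)) (π : RoundPerms n m)
    (i : ℕ) (hi : i ≤ m) (x : Fin (n / 2) → ZMod 2) : ℕ :=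
  hammingNorm (generator B C π i hi *ᵥ x)

open scoped Classical in
/-- The number of messages of `R(BC)^m` whose weight lies in `[h, n - h]` after `m - 1` rounds and
is at most `d` after all `m` rounds. -/
def middleLowCount {n m : ℕ} (B C : Matrix (Fin n) (Fin n) (ZMod 2)) (h d : ℝ)
    (π : RoundPerms n m) : ℕ :=
  (Finset.univ.filter fun x : Fin (n / 2) → ZMod 2 =>
    h ≤ (weightAfter B C π (m - 1) (Nat.sub_le m 1) x : ℝ) ∧
    (weightAfter B C π (m - 1) (Nat.sub_le m 1) x : ℝ) ≤ (n : ℝ) - h ∧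
    (weightAfter B C π m le_rfl x : ℝ) ≤ d).card

/-- The expectation of `middleLowCount` when the `2 m` permutations are independent and
uniformly random: the average over all choices of them. -/
def expectedMiddleLow {n : ℕ} (m : ℕ) (B C : Matrix (Fin n) (Fin n) (ZMod 2)) (h d : ℝ) : ℝ :=
  𝔼 π : RoundPerms n m, (middleLowCount B C h d π : ℝ)

/-! ### The spectral shape function of `RA^m` codes of rate `1/2`, and `δ^(m)` -/

/-- The binary entropy function, with logarithms to base 2. -/
def entropy (x : ℝ) : ℝ := Real.binEntropy x / Real.log 2

/-- The exponent `f_A(α, β)`; it is used for `0 ≤ α ≤ min (2 β) (2 (1 - β))` only. -/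
def fA (α β : ℝ) : ℝ :=
  α - entropy β + (1 - α) * entropy ((β - α / 2) / (1 - α))

/-- The asymptotic spectral shape function after `m` permute-accumulate rounds at rate `1/2`,
for arguments `γ ∈ [0, 1]`. No round leaves the repetition code, with shape `h(γ) / 2`. The
maximum is over all `α` for which `f_A(α, γ)` is defined. -/
def spectralShape : ℕ → ℝ → ℝ
  | 0, γ => entropy γ / 2
  | m + 1, γ =>
      sSup ((fun α => spectralShape m α + fA α γ) '' Set.Icc 0 (min (2 * γ) (2 * (1 - γ))))

/-- `δ^(m)`: the largest `δ < 1/2` such that the spectral shape function of `RA^m` vanishes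
on `[0, δ]`. -/
def delta (m : ℕ) : ℝ :=
  sSup {δ : ℝ | 0 ≤ δ ∧ δ < 1 / 2 ∧ ∀ γ ∈ Set.Icc 0 δ, spectralShape m γ = 0}

/-- The threshold `h = log² n`, with the logarithm to base 2. -/
def threshold (n : ℕ) : ℝ := Real.logb 2 (n : ℝ) ^ 2

end RepeatAccumulate

end

open RepeatAccumulate

/-!
The weights before and after a uniformly permuted accumulator or derivative matrix form a Markov
chain, so the expected numbers of messages of given weights after each round satisfy a linear
recursion. Up to polynomial factors, its kernels are given by exponents: by Stirling's formula,
accumulating takes relative weight `α` to `β` with probability `2 ^ (n f_A(α, β))` (`accExp` is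
`f_A` in natural units), and since `D` inverts `A`, the derivative takes `ω` to `β` with exponent
`f_A(β, ω) + h(β) - h(ω)` (`derExp`). The transposed matrices are conjugate to the original ones
under reversal of the coordinates and have the same kernels.

The definition of the spectral shape accounts for the accumulators only. The crux is that the
derivative does not increase it (`shape_add_derExp_le`): by induction on the rounds, the shape is
symmetric about `1/2`, increases on `[0, 1/2]`, and minus the entropy function it decreases there
(`shape_sub_antitone`). If the derivative raises the weight, monotonicity of the shape suffices.
If it lowers the weight from `ω` to `β`, its exponent is at most `h(β) - h(ω)`, as `f_A ≤ 0`, and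
the second monotonicity applies. Hence `n` times the spectral shape bounds the logarithms of the
expected weight distributions of all four codes up to `O(log n)` (`avgCount_accDer_le`,
`avgCount_derAcc_le`).

In the last round a code must pass from a weight `a` in `[h_n, n - h_n]` to one below
`(δ^(m) - ε) n`. Since `f_A(α, ·)` is strictly increasing with a rate proportional to `α`, and the
shape after `m` rounds still vanishes a little above `δ^(m) - ε`, the exponent of this passage is
at most `-c min (a/n) (1 - a/n)` (`exists_accDer_bound`, `exists_derAcc_bound`; in the first case
even `-c a/n`, and there the derivative must lower the weight by a linear amount if the
accumulator exceeds that point). So each passage contributes at most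
`n ^ O(1) * exp (-c log² n)`, and the polynomially many of them sum to `n ^ (-Ω(log n))`.
-/

namespace RepeatAccumulate

open Real Set

/-! ### The transition exponents -/

/-- The exponent `f_A(α, β)` in natural units, written without divisions: for
`0 ≤ α ≤ min (2 β) (2 (1 - β))` it equals `fA α β * log 2`. -/
noncomputable def accExp (α β : ℝ) : ℝ :=
  α * log 2 + negMulLog (β - α / 2) + negMulLog (1 - β - α / 2) - negMulLog (1 - α) - binEntropy β

/-- The exponent, in natural units, of the probability that the derivative matrix maps a random
vector of relative weight `ω` to one of relative weight `β`. As `D` inverts `A`, it comes from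
`accExp β ω` by exchanging the numbers of vectors of the two weights. -/
noncomputable def derExp (ω β : ℝ) : ℝ := accExp β ω + binEntropy β - binEntropy ω

lemma entropy_mul_log (x : ℝ) : entropy x * log 2 = binEntropy x := by
  have : log 2 ≠ 0 := (log_pos one_lt_two).ne'
  rw [entropy, div_mul_cancel₀ _ this]

lemma mul_binEntropy_div {x y : ℝ} (hx : 0 ≤ x) (hy : 0 ≤ y) :
    (x + y) * binEntropy (x / (x + y)) = negMulLog x + negMulLog y - negMulLog (x + y) := by
  rcases eq_or_ne (x + y) 0 with h | h
  · obtain rfl : x = 0 := by linarith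
    obtain rfl : y = 0 := by linarith
    simp
  · have hx' : negMulLog x = negMulLog ((x + y) * (x / (x + y))) := by
      rw [mul_div_cancel₀ _ h]
    have hy' : negMulLog y = negMulLog ((x + y) * (y / (x + y))) := by
      rw [mul_div_cancel₀ _ h]
    have h1 : 1 - x / (x + y) = y / (x + y) := by field_simp; ring
    rw [hx', hy', negMulLog_mul, negMulLog_mul, binEntropy_eq_negMulLog_add_negMulLog_one_sub, h1]
    field_simp
    ring

lemma fA_mul_log {α β : ℝ} (h1 : α ≤ 2 * β) (h2 : α ≤ 2 * (1 - β)) :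
    fA α β * log 2 = accExp α β := by
  have h := mul_binEntropy_div (x := β - α / 2) (y := 1 - β - α / 2) (by linarith) (by linarith)
  have e : β - α / 2 + (1 - β - α / 2) = 1 - α := by ring
  rw [e] at h
  rw [fA, accExp, add_mul, sub_mul, mul_assoc, entropy_mul_log, entropy_mul_log, h]
  ring

lemma accExp_one_sub (α β : ℝ) : accExp α (1 - β) = accExp α β := by
  rw [accExp, accExp, binEntropy_one_sub, show 1 - (1 - β) - α / 2 = β - α / 2 by ring]
  ring

lemma derExp_one_sub (ω β : ℝ) : derExp (1 - ω) β = derExp ω β := by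
  rw [derExp, derExp, accExp_one_sub, binEntropy_one_sub]

lemma accExp_zero_left (β : ℝ) : accExp 0 β = 0 := by
  simp [accExp, binEntropy_eq_negMulLog_add_negMulLog_one_sub]

lemma hasDerivAt_negMulLog_affine {c k t : ℝ} (h : c + k * t ≠ 0) :
    HasDerivAt (fun s => negMulLog (c + k * s)) ((-log (c + k * t) - 1) * k) t := by
  have h1 : HasDerivAt (fun s : ℝ => c + k * s) k t := by
    simpa using ((hasDerivAt_id t).const_mul k).const_add c
  exact (hasDerivAt_negMulLog h).comp t h1

/-- Heavier inputs are less likely to be accumulated to a given weight: along `α` the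
derivative of `accExp` is `log (4 x y / (x + y) ^ 2) / 2 ≤ 0`. -/
lemma accExp_antitone_left {α₁ α₂ β : ℝ} (h0 : 0 ≤ α₁) (h12 : α₁ ≤ α₂) (h1 : α₂ ≤ 2 * β)
    (h2 : α₂ ≤ 2 * (1 - β)) : accExp α₂ β ≤ accExp α₁ β := by
  have hd : ∀ t ∈ Ioo 0 α₂, HasDerivAt (fun α => accExp α β)
      (log 2 + (-log (β + (-(1/2)) * t) - 1) * (-(1/2)) +
        (-log (1 - β + (-(1/2)) * t) - 1) * (-(1/2)) - (-log (1 + (-1) * t) - 1) * (-1)) t := by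
    intro t ht
    have hx : 0 < β + (-(1/2)) * t := by linarith [ht.2]
    have hy : 0 < 1 - β + (-(1/2)) * t := by linarith [ht.2]
    have hz : 0 < 1 + (-1) * t := by linarith
    have h := ((((hasDerivAt_id t).mul_const (log 2)).add
      (hasDerivAt_negMulLog_affine hx.ne')).add (hasDerivAt_negMulLog_affine hy.ne')).sub
      (hasDerivAt_negMulLog_affine hz.ne')
    refine ((h.sub_const (binEntropy β)).congr_deriv (by ring)).congr_of_eventuallyEq
      (Eventually.of_forall fun s => ?_)
    simp only [accExp, id, Pi.add_apply, Pi.sub_apply]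
    ring_nf
  have hc : Continuous fun α => accExp α β := by unfold accExp; fun_prop
  refine antitoneOn_of_deriv_nonpos (convex_Icc 0 α₂) hc.continuousOn ?_ ?_ ⟨h0, h12⟩
    ⟨h0.trans h12, le_rfl⟩ h12
  · rw [interior_Icc]
    exact fun t ht => (hd t ht).differentiableAt.differentiableWithinAt
  · rw [interior_Icc]
    intro t ht
    rw [(hd t ht).deriv]
    have hx : 0 < β + (-(1/2)) * t := by linarith [ht.2]
    have hy : 0 < 1 - β + (-(1/2)) * t := by linarith [ht.2]
    have hz : 0 < 1 + (-1) * t := by linarith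
    set x := β + (-(1/2)) * t
    set y := 1 - β + (-(1/2)) * t
    have hxy : 1 + (-1) * t = x + y := by simp only [x, y]; ring
    rw [hxy] at hz ⊢
    have key : log (4 * (x * y)) ≤ log ((x + y) ^ 2) :=
      log_le_log (by positivity) (by nlinarith [sq_nonneg (x - y)])
    rw [log_mul (by norm_num) (by positivity), log_mul hx.ne' hy.ne', log_pow,
      show (4 : ℝ) = 2 ^ 2 by norm_num, log_pow] at key
    push_cast at key
    linarith

lemma accExp_nonpos {α β : ℝ} (h0 : 0 ≤ α) (h1 : α ≤ 2 * β) (h2 : α ≤ 2 * (1 - β)) :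
    accExp α β ≤ 0 :=
  (accExp_antitone_left le_rfl h0 h1 h2).trans_eq (accExp_zero_left β)

/-- Strict monotonicity of `accExp α` on `[α / 2, δ]`, with a rate proportional to `α` as long as
`δ` stays away from `1 / 2`. -/
lemma accExp_add_le {α β₁ β₂ δ : ℝ} (h0 : 0 ≤ α) (h1 : α / 2 ≤ β₁) (h12 : β₁ ≤ β₂) (h2 : β₂ ≤ δ)
    (hδ : δ ≤ 1 / 2) :
    accExp α β₁ + (1 - 2 * δ) / 2 * α * (β₂ - β₁) ≤ accExp α β₂ := by
  have hd : ∀ t ∈ Ioo (α / 2) δ, HasDerivAt (fun β => accExp α β)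
      ((-log (-(α/2) + 1 * t) - 1) * 1 +
        (-log (1 - α/2 + (-1) * t) - 1) * (-1) - (log (1 - t) - log t)) t := by
    intro t ht
    have hx : 0 < -(α/2) + 1 * t := by linarith [ht.1]
    have hy : 0 < 1 - α/2 + (-1) * t := by linarith [ht.2, ht.1]
    have h := ((((hasDerivAt_const t (α * log 2)).add
      (hasDerivAt_negMulLog_affine hx.ne')).add (hasDerivAt_negMulLog_affine hy.ne')).sub_const
      (negMulLog (1 - α))).sub (hasDerivAt_binEntropy (p := t) (by linarith [ht.1])
        (by linarith [ht.2]))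
    refine (h.congr_deriv (by ring)).congr_of_eventuallyEq
      (Eventually.of_forall fun s => ?_)
    simp only [accExp, Pi.add_apply, Pi.sub_apply]
    ring_nf
  have hc : Continuous fun β => accExp α β := by unfold accExp; fun_prop
  have := (convex_Icc (α / 2) δ).mul_sub_le_image_sub_of_le_deriv (C := (1 - 2 * δ) / 2 * α)
    hc.continuousOn ?_ ?_ β₁ ⟨h1, h12.trans h2⟩ β₂ ⟨h1.trans h12, h2⟩ h12
  · linarith
  · rw [interior_Icc]
    exact fun t ht => (hd t ht).differentiableAt.differentiableWithinAt
  · rw [interior_Icc]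
    intro t ht
    rw [(hd t ht).deriv]
    have hx : 0 < -(α/2) + 1 * t := by linarith [ht.1]
    have hy : 0 < 1 - α/2 + (-1) * t := by linarith [ht.2, ht.1]
    have ht0 : 0 < t := by linarith [ht.1]
    have ht1 : 0 < 1 - t := by linarith [ht.2]
    set x := -(α/2) + 1 * t with hxd
    set y := 1 - α/2 + (-1) * t with hyd
    -- the derivative is `log (y t / (x (1 - t)))`, estimated by `log u ≥ 1 - 1 / u`
    have key := one_sub_inv_le_log_of_pos (x := y * t / (x * (1 - t))) (by positivity)
    rw [log_div (by positivity) (by positivity), log_mul hy.ne' ht0.ne', log_mul hx.ne' ht1.ne',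
      inv_div] at key
    have h3 : 1 - x * (1 - t) / (y * t) = α / 2 * (1 - 2 * t) / (y * t) := by
      field_simp
      simp only [hxd, hyd]
      ring
    have h4 : α / 2 * (1 - 2 * δ) ≤ α / 2 * (1 - 2 * t) / (y * t) := by
      rw [le_div_iff₀ (by positivity)]
      have hyt : y * t ≤ 1 := by
        have : y ≤ 1 := by simp only [hyd]; linarith
        nlinarith [ht.2]
      calc α / 2 * (1 - 2 * δ) * (y * t) ≤ α / 2 * (1 - 2 * δ) * 1 := by
            gcongr
            exact mul_nonneg (by linarith) (by linarith)
        _ ≤ α / 2 * (1 - 2 * t) := by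
            rw [mul_one]
            gcongr
            exact ht.2.le
    linarith

lemma accExp_mono_right {α β₁ β₂ : ℝ} (h0 : 0 ≤ α) (h1 : α / 2 ≤ β₁) (h12 : β₁ ≤ β₂)
    (h2 : β₂ ≤ 1 / 2) : accExp α β₁ ≤ accExp α β₂ := by
  have := accExp_add_le h0 h1 h12 h2 le_rfl
  linarith

lemma derExp_eq (ω β : ℝ) : derExp ω β = β * log 2 + negMulLog β + negMulLog (ω - β / 2) +
    negMulLog (1 - ω - β / 2) - 2 * negMulLog ω - 2 * negMulLog (1 - ω) := by
  rw [derExp, accExp, binEntropy_eq_negMulLog_add_negMulLog_one_sub ω,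
    binEntropy_eq_negMulLog_add_negMulLog_one_sub β]
  ring

lemma negMulLog_le_gibbs {p q : ℝ} (hp : 0 ≤ p) (hq : 0 < q) :
    negMulLog p ≤ -(p * log q) + q - p := by
  rcases hp.eq_or_lt with rfl | hp
  · simpa using hq.le
  · have := log_le_sub_one_of_pos (x := q / p) (by positivity)
    rw [log_div hq.ne' hp.ne'] at this
    have h2 := mul_le_mul_of_nonneg_left this hp.le
    have : p * (q / p - 1) = q - p := by field_simp
    rw [negMulLog]
    linarith

/-- The entropy of the joint law of two bits, each equal to `1` with probability `ω` and different
with probability `β`, is at most the sum of the entropies of the two bits. -/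
lemma derExp_nonpos {ω β : ℝ} (h0 : 0 ≤ β) (h1 : β ≤ 2 * ω) (h2 : β ≤ 2 * (1 - ω)) :
    derExp ω β ≤ 0 := by
  rw [derExp_eq]
  have hω : 0 ≤ ω := by linarith
  have hω' : 0 ≤ 1 - ω := by linarith
  rcases hω.eq_or_lt with rfl | hω
  · obtain rfl : β = 0 := by linarith
    simp
  rcases hω'.eq_or_lt with h | hω'
  · obtain rfl : ω = 1 := by linarith
    obtain rfl : β = 0 := by linarith
    simp
  have e : β * log 2 + negMulLog β = 2 * negMulLog (β / 2) := by
    rw [div_eq_mul_inv, negMulLog_mul]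
    simp only [negMulLog, log_inv]
    ring
  have g1 := negMulLog_le_gibbs (p := β / 2) (q := ω * (1 - ω)) (by linarith) (by positivity)
  have g2 := negMulLog_le_gibbs (p := ω - β / 2) (q := ω * ω) (by linarith) (by positivity)
  have g3 := negMulLog_le_gibbs (p := 1 - ω - β / 2) (q := (1 - ω) * (1 - ω)) (by linarith)
    (by positivity)
  rw [log_mul hω.ne' hω'.ne'] at g1
  rw [log_mul hω.ne' hω.ne'] at g2
  rw [log_mul hω'.ne' hω'.ne'] at g3
  rw [e]
  simp only [negMulLog] at *
  linarith

/-- Independent bits attain the maximum. -/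
lemma derExp_typical (ω : ℝ) : derExp ω (2 * (ω * (1 - ω))) = 0 := by
  rw [derExp_eq, show ω - 2 * (ω * (1 - ω)) / 2 = ω * ω by ring,
    show 1 - ω - 2 * (ω * (1 - ω)) / 2 = (1 - ω) * (1 - ω) by ring]
  simp only [negMulLog_mul]
  rw [show negMulLog 2 = -2 * log 2 from rfl]
  ring

/-- Below the typical output weight `2 ω (1 - ω)`, an output weight gets less likely as `ω`
grows. -/
lemma derExp_antitone_left {ω₁ ω₂ β : ℝ} (h0 : 0 ≤ β) (h1 : β ≤ 2 * (ω₁ * (1 - ω₁)))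
    (hω : 0 ≤ ω₁) (h12 : ω₁ ≤ ω₂) (h2 : ω₂ ≤ 1 / 2) : derExp ω₂ β ≤ derExp ω₁ β := by
  have hpos : ∀ t ∈ Ioo ω₁ (1 / 2), 0 < t - β / 2 ∧ β / 2 ≤ t * (1 - t) := by
    intro t ht
    constructor <;> nlinarith [ht.1, ht.2]
  have hd : ∀ t ∈ Ioo ω₁ (1 / 2), HasDerivAt (fun ω => derExp ω β)
      ((-log (-(β/2) + 1 * t) - 1) * 1 +
        (-log (1 - β/2 + (-1) * t) - 1) * (-1) - 2 * (log (1 - t) - log t)) t := by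
    intro t ht
    obtain ⟨hx', -⟩ := hpos t ht
    have hx : 0 < -(β/2) + 1 * t := by linarith
    have hy : 0 < 1 - β/2 + (-1) * t := by linarith [ht.2]
    have h := (((hasDerivAt_const t (β * log 2 + binEntropy β - negMulLog (1 - β))).add
      (hasDerivAt_negMulLog_affine hx.ne')).add (hasDerivAt_negMulLog_affine hy.ne')).sub
       ((hasDerivAt_binEntropy (p := t) (by linarith [ht.1])
        (by linarith [ht.2])).const_mul 2)
    refine (h.congr_deriv (by ring)).congr_of_eventuallyEq
      (Eventually.of_forall fun s => ?_)
    simp only [accExp, derExp, Pi.add_apply, Pi.sub_apply]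
    ring_nf
  have hc : Continuous fun ω => derExp ω β := by unfold derExp accExp; fun_prop
  refine antitoneOn_of_deriv_nonpos (convex_Icc ω₁ (1 / 2)) hc.continuousOn ?_ ?_
    ⟨le_rfl, h12.trans h2⟩ ⟨h12, h2⟩ h12
  · rw [interior_Icc]
    exact fun t ht => (hd t ht).differentiableAt.differentiableWithinAt
  · rw [interior_Icc]
    intro t ht
    rw [(hd t ht).deriv]
    obtain ⟨hx', hb⟩ := hpos t ht
    have hx : 0 < -(β/2) + 1 * t := by linarith
    have hy : 0 < 1 - β/2 + (-1) * t := by linarith [ht.2]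
    have ht0 : 0 < t := by linarith [ht.1]
    have ht1 : 0 < 1 - t := by linarith [ht.2]
    have key : log ((1 - β/2 + (-1) * t) * t ^ 2) ≤ log ((-(β/2) + 1 * t) * (1 - t) ^ 2) := by
      refine log_le_log (by positivity) ?_
      have : (-(β/2) + 1 * t) * (1 - t) ^ 2 - (1 - β/2 + (-1) * t) * t ^ 2 =
        (t * (1 - t) - β / 2) * (1 - 2 * t) := by ring
      have : 0 ≤ (t * (1 - t) - β / 2) * (1 - 2 * t) :=
        mul_nonneg (by linarith) (by linarith [ht.2])
      linarith
    rw [log_mul hy.ne' (by positivity), log_mul hx.ne' (by positivity), log_pow, log_pow] at key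
    push_cast at key
    linarith

/-- On `[1/2, 1]` the output weight `β` is less likely than `1 - β`. -/
lemma derExp_le_min {ω β : ℝ} (h1 : β ≤ 2 * ω) (h2 : β ≤ 2 * (1 - ω)) :
    derExp ω β ≤ derExp ω (min β (1 - β)) := by
  rcases le_total β (1 - β) with h | h
  · rw [min_eq_left h]
  · rw [min_eq_right h, derExp, derExp, binEntropy_one_sub]
    have := accExp_antitone_left (α₁ := 1 - β) (α₂ := β) (β := ω) (by linarith) h h1 h2
    linarith

lemma binEntropy_mono {x y : ℝ} (hx : 0 ≤ x) (hxy : x ≤ y) (hy : y ≤ 1 / 2) :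
    binEntropy x ≤ binEntropy y :=
  binEntropy_strictMonoOn.monotoneOn ⟨hx, by linarith⟩ ⟨hx.trans hxy, by linarith⟩ hxy

/-- Half of the entropy of `α` exceeds the entropy of a much smaller `ω` by a multiple of `α`. -/
lemma binEntropy_le_half_sub {α ω : ℝ} (h0 : 0 ≤ ω) (hα : α ≤ 1 / 2) (h : ω ≤ α / 16) :
    binEntropy ω ≤ binEntropy α / 2 - α / 256 := by
  have hα0 : 0 ≤ α := by linarith
  rcases hα0.eq_or_lt with rfl | hα0
  · obtain rfl : ω = 0 := by linarith
    simp
  have m := binEntropy_mono h0 h (by linarith)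
  have e1 := negMulLog_le_one_sub_self (x := 1 - α / 16) (by linarith)
  have e2 := negMulLog_nonneg (x := 1 - α) (by linarith) (by linarith)
  have l16 : log 16 = 4 * log 2 := by
    rw [show (16 : ℝ) = 2 ^ 4 by norm_num, log_pow]; norm_num
  have l2 : log α ≤ -log 2 := by
    rw [← log_inv]; exact log_le_log hα0 (by linarith)
  have hl := log_two_gt_d9
  rw [binEntropy_eq_negMulLog_add_negMulLog_one_sub] at m ⊢
  rw [binEntropy_eq_negMulLog_add_negMulLog_one_sub] at m
  rw [binEntropy_eq_negMulLog_add_negMulLog_one_sub α]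
  have e3 : negMulLog (α / 16) = -(α / 16) * log α + α / 16 * (4 * log 2) := by
    rw [negMulLog, log_div hα0.ne' (by norm_num), l16]; ring
  rw [e3] at m
  have e4 : negMulLog α = -α * log α := rfl
  have : α * log α ≤ α * (-log 2) := mul_le_mul_of_nonneg_left l2 hα0.le
  nlinarith

end RepeatAccumulate

namespace RepeatAccumulate

open Real Set

/-! ### The spectral shape -/

/-- The spectral shape function in natural units. -/
noncomputable def shape (m : ℕ) (γ : ℝ) : ℝ := spectralShape m γ * log 2

lemma shape_zero (γ : ℝ) : shape 0 γ = binEntropy γ / 2 := by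
  rw [shape, spectralShape, div_mul_eq_mul_div, entropy_mul_log]

lemma mem_range_iff {α γ : ℝ} : α ∈ Icc 0 (min (2 * γ) (2 * (1 - γ))) ↔
    0 ≤ α ∧ α ≤ 2 * γ ∧ α ≤ 2 * (1 - γ) := by
  rw [mem_Icc, le_min_iff]

lemma shape_succ_le {m : ℕ} {γ M : ℝ} (h0 : 0 ≤ γ) (h1 : γ ≤ 1)
    (h : ∀ α, 0 ≤ α → α ≤ 2 * γ → α ≤ 2 * (1 - γ) → shape m α + accExp α γ ≤ M) :
    shape (m + 1) γ ≤ M := by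
  have hl : 0 < log 2 := log_pos one_lt_two
  rw [shape, ← le_div_iff₀ hl, spectralShape]
  refine csSup_le ⟨_, 0, mem_range_iff.2 ⟨le_rfl, by linarith, by linarith⟩, rfl⟩ ?_
  rintro _ ⟨α, hα, rfl⟩
  obtain ⟨a0, a1, a2⟩ := mem_range_iff.1 hα
  have := h α a0 a1 a2
  rw [← fA_mul_log a1 a2] at this
  rw [le_div_iff₀ hl, add_mul]
  exact this

lemma add_le_half_binEntropy {m : ℕ} (h : ∀ γ, 0 ≤ γ → γ ≤ 1 → shape m γ ≤ binEntropy γ / 2)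
    {α γ : ℝ} (h0 : 0 ≤ α) (h1 : α ≤ 2 * γ) (h2 : α ≤ 2 * (1 - γ)) :
    shape m α + accExp α γ ≤ binEntropy γ / 2 := by
  have e1 := h α h0 (by linarith)
  have e2 := accExp_nonpos h0 h1 h2
  have e3 := derExp_nonpos h0 h1 h2
  rw [derExp] at e3
  linarith

/-- Accumulation preserves the bound `h / 2`: its exponent is at most `0` and at most
`h γ - h α`, hence at most the mean of the two. -/
lemma shape_le_half (m : ℕ) : ∀ γ, 0 ≤ γ → γ ≤ 1 → shape m γ ≤ binEntropy γ / 2 := by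
  induction m with
  | zero => exact fun γ _ _ => (shape_zero γ).le
  | succ m ih =>
    exact fun γ h0 h1 => shape_succ_le h0 h1 fun α => add_le_half_binEntropy ih

lemma le_shape_succ {m : ℕ} {α γ : ℝ} (h0 : 0 ≤ α) (h1 : α ≤ 2 * γ) (h2 : α ≤ 2 * (1 - γ)) :
    shape m α + accExp α γ ≤ shape (m + 1) γ := by
  have hl : 0 < log 2 := log_pos one_lt_two
  rw [shape, shape, ← fA_mul_log h1 h2, ← add_mul]
  refine mul_le_mul_of_nonneg_right ?_ hl.le
  rw [spectralShape]
  refine le_csSup ⟨binEntropy γ / 2 / log 2, ?_⟩ ⟨α, mem_range_iff.2 ⟨h0, h1, h2⟩, rfl⟩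
  rintro _ ⟨α, hα, rfl⟩
  obtain ⟨a0, a1, a2⟩ := mem_range_iff.1 hα
  have := add_le_half_binEntropy (shape_le_half m) a0 a1 a2
  rwa [shape, ← fA_mul_log a1 a2, ← add_mul, ← le_div_iff₀ hl] at this

lemma shape_one_sub (m : ℕ) (γ : ℝ) : shape m (1 - γ) = shape m γ := by
  cases m with
  | zero => rw [shape_zero, shape_zero, binEntropy_one_sub]
  | succ m =>
    rw [shape, shape, spectralShape, spectralShape, sub_sub_cancel, min_comm]
    congr 2
    refine image_congr fun α hα => ?_
    obtain ⟨-, a1, a2⟩ := mem_range_iff.1 hα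
    have hl : log 2 ≠ 0 := (log_pos one_lt_two).ne'
    have e : fA α (1 - γ) * log 2 = fA α γ * log 2 := by
      rw [fA_mul_log a2 (by linarith), fA_mul_log a1 a2, accExp_one_sub]
    simp only [mul_right_cancel₀ hl e]

lemma shape_min (m : ℕ) (γ : ℝ) : shape m (min γ (1 - γ)) = shape m γ := by
  rcases min_choice γ (1 - γ) with h | h <;> rw [h]
  exact shape_one_sub m γ

lemma binEntropy_min (γ : ℝ) : binEntropy (min γ (1 - γ)) = binEntropy γ := by
  rcases min_choice γ (1 - γ) with h | h <;> rw [h]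
  exact binEntropy_one_sub γ

lemma shape_mono {m : ℕ} {x y : ℝ} (hx : 0 ≤ x) (hxy : x ≤ y) (hy : y ≤ 1 / 2) :
    shape m x ≤ shape m y := by
  cases m with
  | zero =>
    rw [shape_zero, shape_zero]
    linarith [binEntropy_mono hx hxy hy]
  | succ m =>
    refine shape_succ_le hx (by linarith) fun α a0 a1 a2 => ?_
    have := accExp_mono_right a0 (by linarith) hxy hy
    have := le_shape_succ (m := m) a0 (by linarith : α ≤ 2 * y) (by linarith)
    linarith

/-- The shape function minus the entropy function, the exponent of the expected *fraction* of
vectors of a given weight that are codewords, decreases on `[0, 1/2]`. -/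
lemma shape_sub_antitone (m : ℕ) : ∀ x y : ℝ, 0 ≤ x → x ≤ y → y ≤ 1 / 2 →
    shape m y - binEntropy y ≤ shape m x - binEntropy x := by
  induction m with
  | zero =>
    intro x y hx hxy hy
    rw [shape_zero, shape_zero]
    linarith [binEntropy_mono hx hxy hy]
  | succ m ih =>
    intro x y hx hxy hy
    rw [sub_le_iff_le_add]
    refine shape_succ_le (by linarith) (by linarith) fun α a0 a1 a2 => ?_
    -- the exponent is `shape m α - h α + derExp y α`, and passing from `α > 1/2` to `1 - α`
    -- does not decrease it
    have hmin := derExp_le_min a1 a2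
    have hs := shape_min m α
    have hH := binEntropy_min α
    have hd0 := show derExp y α = accExp α y + binEntropy α - binEntropy y from rfl
    set β := min α (1 - α) with hβ
    have b0 : 0 ≤ β := le_min a0 (by linarith)
    have b1 : β ≤ 1 / 2 := by
      rcases le_total α (1 / 2) with h | h
      · exact (min_le_left _ _).trans h
      · exact (min_le_right _ _).trans (by linarith)
    suffices h : ∃ δ, 0 ≤ δ ∧ δ ≤ 2 * x ∧ δ ≤ 2 * (1 - x) ∧
        shape m β - binEntropy β + derExp y β ≤ shape m δ - binEntropy δ + derExp x δ by
      obtain ⟨δ, d0, d1, d2, hδ⟩ := h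
      have h1 := le_shape_succ (m := m) d0 d1 d2
      have h2 := show derExp x δ = accExp δ x + binEntropy δ - binEntropy x from rfl
      linarith
    have hxx : x * (1 - x) ≤ x := by nlinarith
    rcases le_total β (2 * (x * (1 - x))) with h | h
    · refine ⟨β, b0, by linarith, by linarith, ?_⟩
      have := derExp_antitone_left b0 h hx hxy hy
      linarith
    · have d0 : 0 ≤ 2 * (x * (1 - x)) := by
        have : 0 ≤ x * (1 - x) := mul_nonneg hx (by linarith)
        linarith
      refine ⟨2 * (x * (1 - x)), d0, by linarith, by linarith, ?_⟩
      have h1 := ih _ _ d0 h b1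
      have h2 : β ≤ α := min_le_left _ _
      have h3 := derExp_nonpos (ω := y) b0 (by linarith) (by linarith)
      rw [derExp_typical]
      linarith

lemma shape_add_derExp_le_of_half {m : ℕ} {ω β : ℝ} (hω : ω ≤ 1 / 2) (h0 : 0 ≤ β) (h1 : β ≤ 2 * ω)
    (h2 : β ≤ 2 * (1 - ω)) : shape m ω + derExp ω β ≤ shape m β := by
  have hmin := derExp_le_min h1 h2
  rw [← shape_min m β]
  set δ := min β (1 - β) with hδ
  have b0 : 0 ≤ δ := le_min h0 (by linarith)
  have b1 : δ ≤ 1 / 2 := by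
    rcases le_total β (1 / 2) with h | h
    · exact (min_le_left _ _).trans h
    · exact (min_le_right _ _).trans (by linarith)
  have b2 : δ ≤ β := min_le_left _ _
  rcases le_total ω δ with h | h
  · have e1 := shape_mono (m := m) (by linarith) h b1
    have e2 := derExp_nonpos h0 h1 h2
    linarith
  · have e1 := shape_sub_antitone m _ _ b0 h hω
    have e2 := accExp_nonpos b0 (b2.trans h1) (b2.trans h2)
    have e3 := show derExp ω δ = accExp δ ω + binEntropy δ - binEntropy ω from rfl
    linarith

/-- The derivative matrix does not increase the spectral shape. If the weight grows, the shape
grows with it; if it drops, `shape_sub_antitone` applies. -/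
theorem shape_add_derExp_le {m : ℕ} {ω β : ℝ} (h0 : 0 ≤ β) (h1 : β ≤ 2 * ω)
    (h2 : β ≤ 2 * (1 - ω)) : shape m ω + derExp ω β ≤ shape m β := by
  rcases le_total ω (1 / 2) with h | h
  · exact shape_add_derExp_le_of_half h h0 h1 h2
  · rw [← shape_one_sub m ω, ← derExp_one_sub]
    exact shape_add_derExp_le_of_half (by linarith) h0 (by linarith) (by linarith)

/-! ### The last round -/

lemma exists_shape_eq_zero {m : ℕ} {β : ℝ} (h0 : 0 ≤ β) (h : β < delta m) :
    ∃ δ, β < δ ∧ δ < 1 / 2 ∧ ∀ γ, 0 ≤ γ → γ ≤ δ → shape m γ = 0 := by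
  have hne : {δ : ℝ | 0 ≤ δ ∧ δ < 1 / 2 ∧ ∀ γ ∈ Icc 0 δ, spectralShape m γ = 0}.Nonempty := by
    by_contra hn
    rw [delta, not_nonempty_iff_eq_empty.1 hn, Real.sSup_empty] at h
    linarith
  obtain ⟨δ, ⟨-, h1, h2⟩, h3⟩ := exists_lt_of_lt_csSup hne h
  exact ⟨δ, h3, h1, fun γ g0 g1 => by rw [shape, h2 γ ⟨g0, g1⟩, zero_mul]⟩

/-- Below the point `δ`, the shape of `m` rounds plus the accumulator exponent is negative, and
proportionally so to the weight before accumulation. -/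
lemma shape_add_accExp_le {m : ℕ} {β δ : ℝ} (hβ : β < δ) (hδ : δ < 1 / 2)
    (hz : ∀ γ, 0 ≤ γ → γ ≤ δ → shape (m + 1) γ = 0) :
    ∃ c, 0 < c ∧ ∀ α ω, ω ≤ β → 0 ≤ α → α ≤ 2 * ω → shape m α + accExp α ω ≤ -(c * α) := by
  refine ⟨(1 - 2 * δ) / 2 * (δ - β), mul_pos (by linarith) (by linarith),
    fun α ω hω h0 h1 => ?_⟩
  have e1 := accExp_add_le h0 (by linarith : α / 2 ≤ ω) (by linarith : ω ≤ δ) le_rfl hδ.le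
  have e2 := le_shape_succ (m := m) h0 (by linarith : α ≤ 2 * δ) (by linarith)
  rw [hz δ (by linarith) le_rfl] at e2
  have e3 : (1 - 2 * δ) / 2 * α * (δ - β) ≤ (1 - 2 * δ) / 2 * α * (δ - ω) := by
    gcongr
    exact mul_nonneg (by linarith) h0
  nlinarith

/-- The exponent of a round that first accumulates and then differentiates, down to a relative
weight at most `β < δ^(m + 1)`. -/
lemma exists_accDer_bound {m : ℕ} {β : ℝ} (h0 : 0 ≤ β) (h : β < delta (m + 1)) :
    ∃ c, 0 < c ∧ ∀ α ω γ, 0 ≤ α → α ≤ 2 * ω → α ≤ 2 * (1 - ω) → 0 ≤ γ → γ ≤ 2 * ω →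
      γ ≤ 2 * (1 - ω) → γ ≤ β → shape m α + accExp α ω + derExp ω γ ≤ -(c * α) := by
  obtain ⟨δ, hβδ, hδ, hz⟩ := exists_shape_eq_zero h0 h
  obtain ⟨c₁, hc₁, H⟩ := shape_add_accExp_le (m := m) (β := (β + δ) / 2) (by linarith) hδ hz
  have hc₂ : 0 < binEntropy ((β + δ) / 2) - binEntropy β := by
    have := binEntropy_strictMonoOn (a := β) (b := (β + δ) / 2) ⟨h0, by linarith⟩
      ⟨by linarith, by linarith⟩ (by linarith)
    linarith
  refine ⟨min c₁ (binEntropy ((β + δ) / 2) - binEntropy β), lt_min hc₁ hc₂, ?_⟩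
  have key : ∀ α ω γ, ω ≤ 1 / 2 → 0 ≤ α → α ≤ 2 * ω → α ≤ 2 * (1 - ω) → 0 ≤ γ → γ ≤ 2 * ω →
      γ ≤ 2 * (1 - ω) → γ ≤ β → shape m α + accExp α ω + derExp ω γ ≤
        -(min c₁ (binEntropy ((β + δ) / 2) - binEntropy β) * α) := by
    intro α ω γ hω a0 a1 a2 g0 g1 g2 g3
    have hD := derExp_nonpos g0 g1 g2
    rcases le_total ω ((β + δ) / 2) with hw | hw
    · have e1 := H α ω hw a0 a1
      have e2 := mul_le_mul_of_nonneg_right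
        (min_le_left c₁ (binEntropy ((β + δ) / 2) - binEntropy β)) a0
      linarith
    · have e1 := le_shape_succ (m := m) a0 a1 a2
      have e2 := shape_sub_antitone (m + 1) ((β + δ) / 2) ω (by linarith) hw hω
      rw [hz ((β + δ) / 2) (by linarith) (by linarith)] at e2
      have e3 := accExp_nonpos g0 g1 g2
      have e4 := show derExp ω γ = accExp γ ω + binEntropy γ - binEntropy ω from rfl
      have e5 := binEntropy_mono g0 g3 (by linarith)
      have e6 := mul_le_mul_of_nonneg_right
        (min_le_right c₁ (binEntropy ((β + δ) / 2) - binEntropy β)) a0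
      have e7 : (binEntropy ((β + δ) / 2) - binEntropy β) * α ≤
          (binEntropy ((β + δ) / 2) - binEntropy β) * 1 := by
        gcongr
        linarith
      linarith
  intro α ω γ a0 a1 a2 g0 g1 g2 g3
  rcases le_total ω (1 / 2) with hω | hω
  · exact key α ω γ hω a0 a1 a2 g0 g1 g2 g3
  · have := key α (1 - ω) γ (by linarith) a0 a2 (by linarith) g0 g2 (by linarith) g3
    rwa [accExp_one_sub, derExp_one_sub] at this

/-- The exponent of a round that first differentiates and then accumulates, down to a relative
weight at most `β < δ^(m + 1)`. -/
lemma exists_derAcc_bound {m : ℕ} {β : ℝ} (h0 : 0 ≤ β) (h : β < delta (m + 1)) :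
    ∃ c, 0 < c ∧ ∀ α ω γ, 0 ≤ ω → ω ≤ 2 * α → ω ≤ 2 * (1 - α) → ω ≤ 2 * γ →
      γ ≤ β → shape m α + derExp α ω + accExp ω γ ≤ -(c * min α (1 - α)) := by
  obtain ⟨δ, hβδ, hδ, hz⟩ := exists_shape_eq_zero h0 h
  obtain ⟨c₁, hc₁, H⟩ := shape_add_accExp_le (m := m) hβδ hδ hz
  refine ⟨min (c₁ / 16) (1 / 256), by positivity, ?_⟩
  have key : ∀ α ω γ, α ≤ 1 / 2 → 0 ≤ ω → ω ≤ 2 * α → ω ≤ 2 * (1 - α) → ω ≤ 2 * γ →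
      γ ≤ β → shape m α + derExp α ω + accExp ω γ ≤ -(min (c₁ / 16) (1 / 256) * α) := by
    intro α ω γ hα w0 w1 w2 w3 hγ
    have hα0 : 0 ≤ α := by linarith
    rcases le_total (α / 16) ω with hw | hw
    · have e1 := shape_add_derExp_le (m := m) w0 w1 w2
      have e2 := H ω γ hγ w0 w3
      have e3 := mul_le_mul_of_nonneg_right (min_le_left (c₁ / 16) (1 / 256)) hα0
      nlinarith
    · have e1 := shape_le_half m α hα0 (by linarith)
      have e2 := binEntropy_le_half_sub w0 hα hw
      have e3 := accExp_nonpos w0 w1 w2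
      have e4 := show derExp α ω = accExp ω α + binEntropy ω - binEntropy α from rfl
      have e5 := accExp_nonpos (β := γ) w0 w3 (by linarith)
      have e6 := mul_le_mul_of_nonneg_right (min_le_right (c₁ / 16) (1 / 256)) hα0
      linarith
  intro α ω γ w0 w1 w2 w3 hγ
  rcases le_total α (1 / 2) with hα | hα
  · rw [min_eq_left (by linarith : α ≤ 1 - α)]
    exact key α ω γ hα w0 w1 w2 w3 hγ
  · rw [min_eq_right (by linarith : 1 - α ≤ α)]
    have := key (1 - α) ω γ (by linarith) w0 w2 (by linarith) w3 hγ
    rwa [shape_one_sub, derExp_one_sub] at this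

end RepeatAccumulate

namespace RepeatAccumulate

open Finset

/-! ### Counting transitions -/

/-- The number of vectors of weight `a` that the matrix `M` maps to vectors of weight `b`. -/
def transCount {n : ℕ} (M : Matrix (Fin n) (Fin n) (ZMod 2)) (a b : ℕ) : ℕ :=
  #{x : Fin n → ZMod 2 | hammingNorm x = a ∧ hammingNorm (M *ᵥ x) = b}

/-- The upper bound on the number of transitions from weight `a` to weight `w` that is all the
argument uses about the accumulator matrix. -/
def IsAccumulatorLike {n : ℕ} (M : Matrix (Fin n) (Fin n) (ZMod 2)) : Prop :=
  ∀ a w, transCount M a w ≤ (n - w).choose (a / 2) * w.choose (a / 2)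

/-- The upper bound on the number of transitions from weight `w` to weight `a` that is all the
argument uses about the derivative matrix. -/
def IsDerivativeLike {n : ℕ} (M : Matrix (Fin n) (Fin n) (ZMod 2)) : Prop :=
  ∀ w a, transCount M w a ≤ (n - w).choose (a / 2) * w.choose (a / 2)

/-- The changes along the bit sequence `s, y 0, y 1, …`. -/
def changes {n : ℕ} (s : ZMod 2) (y : Fin n → ZMod 2) : Fin n → ZMod 2 :=
  fun i => y i + (Fin.cons s y : Fin (n + 1) → ZMod 2) i.castSucc

lemma changes_cons {n : ℕ} (s b : ZMod 2) (y : Fin n → ZMod 2) :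
    changes s (Fin.cons b y : Fin (n + 1) → ZMod 2) = Fin.cons (b + s) (changes b y) := by
  funext i
  refine Fin.cases ?_ (fun i => ?_) i
  · simp [changes]
  · simp only [changes, Fin.cons_succ, ← Fin.succ_castSucc]

lemma hammingNorm_cons {n : ℕ} (b : ZMod 2) (y : Fin n → ZMod 2) :
    hammingNorm (Fin.cons b y : Fin (n + 1) → ZMod 2) =
      (if b = 0 then 0 else 1) + hammingNorm y := by
  rw [hammingNorm, hammingNorm, card_filter, card_filter, Fin.sum_univ_succ]
  simp only [Fin.cons_zero, Fin.cons_succ, ne_eq, ite_not]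

/-- The number of bit sequences of weight `w` with `a` changes when preceded by the bit `s`. -/
def changeCount (n : ℕ) (s : ZMod 2) (a w : ℕ) : ℕ :=
  #{y : Fin n → ZMod 2 | hammingNorm y = w ∧ hammingNorm (changes s y) = a}

lemma changeCount_eq_zero {n : ℕ} {s : ZMod 2} {a w : ℕ} (h : n < w) :
    changeCount n s a w = 0 := by
  rw [changeCount, card_eq_zero, filter_eq_empty_iff]
  rintro y - ⟨rfl, -⟩
  have : hammingNorm y ≤ Fintype.card (Fin n) := hammingNorm_le_card_fintype
  rw [Fintype.card_fin] at this
  omega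

lemma changeCount_succ (n : ℕ) (s : ZMod 2) (a w : ℕ) :
    changeCount (n + 1) s a w =
      #{y : Fin n → ZMod 2 | hammingNorm y = w ∧
        (if s = 0 then 0 else 1) + hammingNorm (changes 0 y) = a} +
      #{y : Fin n → ZMod 2 | 1 + hammingNorm y = w ∧
        (if 1 + s = 0 then 0 else 1) + hammingNorm (changes 1 y) = a} := by
  simp only [changeCount, card_filter]
  rw [← (Fin.consEquiv fun _ => ZMod 2).sum_comp, Fintype.sum_prod_type]
  refine (Fin.sum_univ_two _).trans ?_
  congr 1
  · refine sum_congr rfl fun y _ => ?_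
    change (if hammingNorm (Fin.cons 0 y : Fin (n + 1) → ZMod 2) = w ∧
      hammingNorm (changes s (Fin.cons 0 y : Fin (n + 1) → ZMod 2)) = a then 1 else 0) = _
    rw [changes_cons, hammingNorm_cons, hammingNorm_cons, zero_add, if_pos rfl, zero_add]
  · refine sum_congr rfl fun y _ => ?_
    change (if hammingNorm (Fin.cons 1 y : Fin (n + 1) → ZMod 2) = w ∧
      hammingNorm (changes s (Fin.cons 1 y : Fin (n + 1) → ZMod 2)) = a then 1 else 0) = _
    rw [changes_cons, hammingNorm_cons, hammingNorm_cons, if_neg (one_ne_zero)]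

lemma card_filter_one_add {n w a : ℕ} (f : (Fin n → ZMod 2) → ℕ) (g : (Fin n → ZMod 2) → ℕ) :
    #{y | 1 + f y = w + 1 ∧ 1 + g y = a + 1} = #{y | f y = w ∧ g y = a} := by
  congr 1
  ext y
  simp only [mem_filter, mem_univ, true_and]
  omega

/-- The number of bit sequences with `z` zeros, `w` ones, and `a` changes when preceded by a zero:
there are `a / 2` (rounded up) runs of ones and, between and after them, `a / 2` (rounded down)
runs of zeros besides the possibly empty first one. -/
def runCount : ℕ → ℕ → ℕ → ℕ
  | _, 0, 0 => 1
  | _, 0, _ + 1 => 0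
  | _, _ + 1, 0 => 0
  | z, w + 1, a + 1 => z.choose ((a + 1) / 2) * w.choose (a / 2)

lemma runCount_add_le (z w a : ℕ) :
    runCount z (w + 1) (a + 1) + runCount w (z + 1) a ≤ runCount (z + 1) (w + 1) (a + 1) := by
  cases a with
  | zero => simp [runCount]
  | succ a =>
    have e : (a + 1 + 1) / 2 = a / 2 + 1 := by omega
    simp only [runCount, e, Nat.choose_succ_succ z (a / 2)]
    exact le_of_eq (by ring)

lemma runCount_le (z w a : ℕ) : runCount z w a ≤ z.choose (a / 2) * w.choose (a / 2) := by
  match w, a with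
  | 0, 0 => simp [runCount]
  | 0, _ + 1 => simp [runCount]
  | _ + 1, 0 => simp [runCount]
  | w + 1, a + 1 =>
    rw [runCount]
    refine Nat.mul_le_mul le_rfl ?_
    rcases Nat.even_or_odd' a with ⟨j, rfl | rfl⟩
    · rw [show (2 * j + 1) / 2 = j by omega, show 2 * j / 2 = j by omega]
      exact Nat.choose_le_choose _ (Nat.le_succ w)
    · rw [show (2 * j + 1 + 1) / 2 = j + 1 by omega, show (2 * j + 1) / 2 = j by omega,
        Nat.choose_succ_succ]
      exact Nat.le_add_right _ _

lemma changeCount_le (n : ℕ) : ∀ z w a, z + w = n →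
    changeCount n 0 a w ≤ runCount z w a ∧ changeCount n 1 a w ≤ runCount w z a := by
  induction n with
  | zero =>
    intro z w a h
    obtain ⟨rfl, rfl⟩ : z = 0 ∧ w = 0 := by omega
    cases a with
    | zero => exact ⟨(card_le_univ _).trans (by simp [runCount]),
        (card_le_univ _).trans (by simp [runCount])⟩
    | succ a => simp [changeCount, hammingNorm, runCount]
  | succ n ih =>
    have e1 : (1 : ZMod 2) + 1 = 0 := rfl
    -- the first bit either repeats the preceding bit, or differs from it and counts as a change
    have h0 : ∀ a w, changeCount (n + 1) 0 (a + 1) (w + 1) =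
        changeCount n 0 (a + 1) (w + 1) + changeCount n 1 a w := by
      intro a w
      rw [changeCount_succ]
      simp only [if_true, add_zero, zero_add, one_ne_zero, if_false, card_filter_one_add]
      rfl
    have h0' : ∀ a, changeCount (n + 1) 0 a 0 = changeCount n 0 a 0 := by
      intro a
      rw [changeCount_succ]
      simp [changeCount]
    have h0'' : ∀ w, changeCount (n + 1) 0 0 w = changeCount n 0 0 w := by
      intro a
      rw [changeCount_succ]
      simp [changeCount]
    have h1 : ∀ a w, changeCount (n + 1) 1 (a + 1) w =
        #{y : Fin n → ZMod 2 | 1 + hammingNorm y = w ∧ hammingNorm (changes 1 y) = a + 1} +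
          changeCount n 0 a w := by
      intro a w
      rw [changeCount_succ, add_comm]
      simp only [e1, if_true, zero_add, one_ne_zero, if_false]
      congr 1
      rw [changeCount]
      congr 1
      ext y
      simp only [mem_filter, mem_univ, true_and]
      omega
    have h1' : ∀ w, changeCount (n + 1) 1 0 w =
        #{y : Fin n → ZMod 2 | 1 + hammingNorm y = w ∧ hammingNorm (changes 1 y) = 0} := by
      intro w
      rw [changeCount_succ, add_comm]
      simp only [e1, if_true, zero_add, one_ne_zero, if_false]
      simp
    have hs : ∀ a w, #{y : Fin n → ZMod 2 | 1 + hammingNorm y = w + 1 ∧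
        hammingNorm (changes 1 y) = a} = changeCount n 1 a w := by
      intro a w
      rw [changeCount]
      congr 1
      ext y
      simp only [mem_filter, mem_univ, true_and]
      omega
    have hz : ∀ a, #{y : Fin n → ZMod 2 | 1 + hammingNorm y = 0 ∧
        hammingNorm (changes 1 y) = a} = 0 := by
      intro a
      simp
    intro z w a h
    constructor
    · match z, w, a with
      | 0, w + 1, 0 =>
        rw [h0'', changeCount_eq_zero (by omega)]
        exact Nat.zero_le _
      | z + 1, w, 0 =>
        rw [h0'']
        refine (ih z w 0 (by omega)).1.trans ?_
        cases w <;> simp [runCount]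
      | z + 1, 0, a + 1 =>
        rw [h0']
        exact (ih z 0 (a + 1) (by omega)).1
      | 0, w + 1, a + 1 =>
        rw [h0, changeCount_eq_zero (by omega), zero_add]
        refine (ih 0 w a (by omega)).2.trans ?_
        cases a <;> simp [runCount]
      | z + 1, w + 1, a + 1 =>
        rw [h0]
        exact (add_le_add (ih z (w + 1) (a + 1) (by omega)).1
          (ih (z + 1) w a (by omega)).2).trans (runCount_add_le z w a)
    · match w, z, a with
      | 0, z, 0 =>
        rw [h1', hz]
        exact Nat.zero_le _
      | w + 1, z, 0 =>
        rw [h1', hs]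
        refine (ih z w 0 (by omega)).2.trans ?_
        cases z <;> simp [runCount]
      | w + 1, 0, a + 1 =>
        rw [h1, hs, changeCount_eq_zero (s := 0) (by omega), add_zero]
        exact (ih 0 w (a + 1) (by omega)).2
      | 0, z + 1, a + 1 =>
        rw [h1, hz, zero_add]
        refine (ih z 0 a (by omega)).1.trans ?_
        cases a <;> simp [runCount]
      | w + 1, z + 1, a + 1 =>
        rw [h1, hs]
        exact (add_le_add (ih (z + 1) w (a + 1) (by omega)).2
          (ih z (w + 1) a (by omega)).1).trans (runCount_add_le w z a)

lemma derivative_mulVec {n : ℕ} (y : Fin n → ZMod 2) : derivative n *ᵥ y = changes 0 y := by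
  cases n with
  | zero => exact Subsingleton.elim _ _
  | succ n =>
    funext i
    have hsplit : ∀ j : Fin (n + 1), derivative (n + 1) i j * y j =
        (if i = j then y j else 0) + (if (i : ℕ) = (j : ℕ) + 1 then y j else 0) := by
      intro j
      rw [derivative, Matrix.of_apply, ite_mul, one_mul, zero_mul]
      by_cases h1 : i = j
      · subst h1
        simp
      · simp [h1]
    rw [Matrix.mulVec, dotProduct, sum_congr rfl fun j _ => hsplit j, sum_add_distrib,
      sum_ite_eq, if_pos (mem_univ i), changes]
    congr 1
    refine Fin.cases ?_ (fun i => ?_) i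
    · simp
    · have : ∀ j : Fin (n + 1), ((i.succ : ℕ) = (j : ℕ) + 1) ↔ i.castSucc = j := by
        intro j
        rw [Fin.ext_iff, Fin.val_succ, Fin.val_castSucc]
        omega
      simp only [this, sum_ite_eq, mem_univ, if_true, ← Fin.succ_castSucc, Fin.cons_succ]

lemma derivative_mul_accumulator (n : ℕ) : derivative n * accumulator n = 1 := by
  ext i j
  have h : (derivative n * accumulator n) i j = (derivative n *ᵥ (fun k => accumulator n k j)) i :=
    rfl
  rw [h, derivative_mulVec, changes]
  cases n with
  | zero => exact i.elim0
  | succ n =>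
    have e1 : (1 : ZMod 2) + 1 = 0 := rfl
    induction i using Fin.cases with
    | zero =>
      simp only [accumulator, Matrix.of_apply, Fin.castSucc_zero, Fin.cons_zero, add_zero,
        Matrix.one_apply, Fin.le_zero_iff, eq_comm]
    | succ i =>
      simp only [accumulator, Matrix.of_apply, ← Fin.succ_castSucc, Fin.cons_succ,
        Matrix.one_apply, Fin.le_def, Fin.ext_iff, Fin.val_succ, Fin.val_castSucc]
      rcases lt_trichotomy (j : ℕ) (i + 1) with h | h | h
      · rw [if_pos h.le, if_pos (by omega), if_neg (by omega), e1]
      · rw [if_pos h.le, if_neg (by omega), if_pos (by omega), add_zero]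
      · rw [if_neg (by omega), if_neg (by omega), if_neg (by omega), add_zero]

lemma isDerivativeLike_derivative (n : ℕ) : IsDerivativeLike (derivative n) := by
  intro w a
  have e : transCount (derivative n) w a = changeCount n 0 a w := by
    simp only [transCount, changeCount, derivative_mulVec]
  rw [e]
  rcases le_or_gt w n with h | h
  · exact (changeCount_le n (n - w) w a (by omega)).1.trans (runCount_le _ _ _)
  · rw [changeCount_eq_zero h]
    exact Nat.zero_le _

lemma isAccumulatorLike_accumulator (n : ℕ) : IsAccumulatorLike (accumulator n) := by
  intro a w
  refine le_trans ?_ (isDerivativeLike_derivative n w a)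
  have hD : ∀ x : Fin n → ZMod 2, derivative n *ᵥ (accumulator n *ᵥ x) = x := fun x => by
    rw [Matrix.mulVec_mulVec, derivative_mul_accumulator, Matrix.one_mulVec]
  refine card_le_card_of_injOn (fun x => accumulator n *ᵥ x) ?_ ?_
  · intro x hx
    obtain ⟨-, h1, h2⟩ := mem_filter.1 (mem_coe.1 hx)
    refine mem_coe.2 (mem_filter.2 ⟨mem_univ _, h2, ?_⟩)
    rw [hD, h1]
  · intro x _ y _ h
    rw [← hD x, ← hD y]
    exact congrArg _ h

lemma hammingNorm_comp_equiv {n : ℕ} (x : Fin n → ZMod 2) (σ : Equiv.Perm (Fin n)) :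
    hammingNorm (x ∘ σ) = hammingNorm x := by
  rw [hammingNorm, hammingNorm, card_filter, card_filter]
  exact Equiv.sum_comp σ fun i => if x i ≠ 0 then 1 else 0

lemma transCount_submatrix {n : ℕ} (M : Matrix (Fin n) (Fin n) (ZMod 2))
    (σ : Equiv.Perm (Fin n)) (a b : ℕ) :
    transCount (M.submatrix σ σ) a b = transCount M a b := by
  refine card_nbij' (fun x => x ∘ σ.symm) (fun x => x ∘ σ) ?_ ?_ ?_ ?_
  · intro x hx
    obtain ⟨-, h1, h2⟩ := mem_filter.1 (mem_coe.1 hx)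
    refine mem_coe.2 (mem_filter.2 ⟨mem_univ _, ?_, ?_⟩)
    · rw [hammingNorm_comp_equiv, h1]
    · rwa [Matrix.submatrix_mulVec_equiv, hammingNorm_comp_equiv] at h2
  · intro x hx
    obtain ⟨-, h1, h2⟩ := mem_filter.1 (mem_coe.1 hx)
    refine mem_coe.2 (mem_filter.2 ⟨mem_univ _, ?_, ?_⟩)
    · rw [hammingNorm_comp_equiv, h1]
    · rw [Matrix.submatrix_mulVec_equiv, hammingNorm_comp_equiv]
      simpa [Function.comp_assoc] using h2
  · intro x _
    simp [Function.comp_assoc]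
  · intro x _
    simp [Function.comp_assoc]

lemma isAccumulatorLike_transpose (n : ℕ) : IsAccumulatorLike (accumulator n)ᵀ := by
  have e : (accumulator n)ᵀ = (accumulator n).submatrix Fin.revPerm Fin.revPerm := by
    ext i j
    simp [accumulator]
  intro a w
  rw [e, transCount_submatrix]
  exact isAccumulatorLike_accumulator n a w

lemma isDerivativeLike_transpose (n : ℕ) : IsDerivativeLike (derivative n)ᵀ := by
  have e : (derivative n)ᵀ = (derivative n).submatrix Fin.revPerm Fin.revPerm := by
    ext i j
    have h : (j = i ∨ (j : ℕ) = i + 1) ↔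
        (Fin.rev i = Fin.rev j ∨ (Fin.rev i : ℕ) = (Fin.rev j : ℕ) + 1) := by
      simp only [Fin.ext_iff, Fin.val_rev]
      omega
    simp only [derivative, Matrix.transpose_apply, Matrix.of_apply, Matrix.submatrix_apply,
      Fin.revPerm_apply, h]
  intro w a
  rw [e, transCount_submatrix]
  exact isDerivativeLike_derivative n w a

end RepeatAccumulate

namespace RepeatAccumulate

open Real

/-! ### From binomial coefficients to exponents -/

lemma mul_log_sub_le_log_factorial (k : ℕ) : k * log k - k ≤ log (k.factorial) := by
  induction k with
  | zero => simp
  | succ k ih =>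
    rw [Nat.factorial_succ, Nat.cast_mul, log_mul (by positivity) (by positivity)]
    rcases Nat.eq_zero_or_pos k with rfl | hk
    · simp
    · have hk' : (0 : ℝ) < k := by exact_mod_cast hk
      have h := log_le_sub_one_of_pos (x := ((k + 1 : ℕ) : ℝ) / k) (by positivity)
      rw [log_div (by positivity) hk'.ne'] at h
      have h2 := mul_le_mul_of_nonneg_left h hk'.le
      have : (k : ℝ) * (((k + 1 : ℕ) : ℝ) / k - 1) = 1 := by
        push_cast; field_simp; ring
      push_cast at *
      nlinarith

lemma log_factorial_le_aux (k : ℕ) :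
    log ((k + 1).factorial) ≤
      (k + 1 : ℕ) * log (k + 1 : ℕ) - (k + 1 : ℕ) + (log (k + 1 : ℕ) + 1) := by
  induction k with
  | zero => simp
  | succ k ih =>
    rw [Nat.factorial_succ, Nat.cast_mul, log_mul (by positivity) (by positivity)]
    have hk' : (0 : ℝ) < (k + 1 : ℕ) := by positivity
    have h := one_sub_inv_le_log_of_pos (x := ((k + 1 + 1 : ℕ) : ℝ) / (k + 1 : ℕ)) (by positivity)
    rw [log_div (by positivity) hk'.ne', inv_div] at h
    have h2 := mul_le_mul_of_nonneg_left h (by positivity : (0 : ℝ) ≤ (k + 1 + 1 : ℕ))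
    have : ((k + 1 + 1 : ℕ) : ℝ) * (1 - ((k + 1 : ℕ) : ℝ) / (k + 1 + 1 : ℕ)) = 1 := by
      push_cast; field_simp; ring
    push_cast at *
    nlinarith

lemma log_factorial_le {k n : ℕ} (hkn : k ≤ n) (hn : 1 ≤ n) :
    log (k.factorial) ≤ k * log k - k + (log n + 1) := by
  have hn' : (1 : ℝ) ≤ n := by exact_mod_cast hn
  cases k with
  | zero => simpa using by linarith [log_nonneg hn']
  | succ k =>
    have := log_le_log (by positivity) (Nat.cast_le (α := ℝ).2 hkn)
    have := log_factorial_le_aux k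
    linarith

lemma log_choose_add (a b : ℕ) : log ((a + b).choose b) =
    log ((a + b).factorial) - log (a.factorial) - log (b.factorial) := by
  have h := Nat.add_choose_mul_factorial_mul_factorial a b
  have hc : ((a + b).choose b : ℝ) ≠ 0 := by
    exact_mod_cast (Nat.choose_pos (Nat.le_add_left b a)).ne'
  rw [← h]
  push_cast
  rw [log_mul (mul_ne_zero hc (by positivity)) (by positivity), log_mul hc (by positivity)]
  ring

lemma mul_negMulLog_div {n x : ℝ} (hn : 0 < n) :
    n * negMulLog (x / n) = x * log n - x * log x := by
  rcases eq_or_ne x 0 with rfl | hx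
  · simp
  · rw [negMulLog, log_div hx hn.ne']
    field_simp
    ring

lemma mul_log_two_mul (k : ℝ) : 2 * k * log (2 * k) = 2 * k * log 2 + 2 * (k * log k) := by
  rcases eq_or_ne k 0 with rfl | hk
  · simp
  · rw [log_mul two_ne_zero hk]
    ring

lemma acc_choose_le {n u v k : ℕ} (h : u + v + 2 * k = n) (hn : 1 ≤ n) :
    log ((v + k).choose k) + log ((u + k).choose k) - log (n.choose (2 * k)) ≤
      4 * (log n + 1) + n * accExp (2 * k / n) ((u + k) / n) := by
  have hn' : (0 : ℝ) < n := by exact_mod_cast hn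
  subst h
  rw [log_choose_add, log_choose_add, log_choose_add]
  have l1 := mul_log_sub_le_log_factorial k
  have l2 := mul_log_sub_le_log_factorial u
  have l3 := mul_log_sub_le_log_factorial v
  have l4 := mul_log_sub_le_log_factorial (u + v + 2 * k)
  have u1 := log_factorial_le (show v + k ≤ u + v + 2 * k by omega) hn
  have u2 := log_factorial_le (show u + k ≤ u + v + 2 * k by omega) hn
  have u3 := log_factorial_le (show 2 * k ≤ u + v + 2 * k by omega) hn
  have u4 := log_factorial_le (show u + v ≤ u + v + 2 * k by omega) hn
  rw [accExp, binEntropy_eq_negMulLog_add_negMulLog_one_sub]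
  set N : ℝ := ((u + v + 2 * k : ℕ) : ℝ) with hN
  have hN' : N = u + v + 2 * k := by rw [hN]; push_cast; ring
  have d1 : ((u : ℝ) + k) / N - 2 * k / N / 2 = u / N := by field_simp; ring
  have d2 : 1 - ((u : ℝ) + k) / N - 2 * k / N / 2 = v / N := by
    field_simp; rw [hN']; ring
  have d3 : 1 - 2 * (k : ℝ) / N = (u + v) / N := by field_simp; rw [hN']; ring
  have d4 : 1 - ((u : ℝ) + k) / N = (v + k) / N := by field_simp; rw [hN']; ring
  rw [d1, d2, d3, d4]
  have e1 := mul_negMulLog_div (x := (u : ℝ)) hn'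
  have e2 := mul_negMulLog_div (x := (v : ℝ)) hn'
  have e3 := mul_negMulLog_div (x := (u + v : ℝ)) hn'
  have e4 := mul_negMulLog_div (x := (v + k : ℝ)) hn'
  have e5 := mul_negMulLog_div (x := (u + k : ℝ)) hn'
  have e6 := mul_log_two_mul (k : ℝ)
  have e7 : N * (2 * k / N * log 2) = 2 * k * log 2 := by field_simp
  have e8 : N * log N = u * log N + v * log N + 2 * k * log N := by
    nth_rewrite 1 [hN']; ring
  push_cast at u1 u2 u3 u4
  simp only [mul_sub, mul_add]
  rw [e1, e2, e3, e4, e5, e7]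
  linarith

lemma der_choose_le {n u v k : ℕ} (h : u + v + 2 * k = n) (hn : 1 ≤ n) :
    log ((v + k).choose k) + log ((u + k).choose k) - log (n.choose (u + k)) ≤
      4 * (log n + 1) + n * derExp ((u + k) / n) (2 * k / n) := by
  have hn' : (0 : ℝ) < n := by exact_mod_cast hn
  obtain rfl : (v + k) + (u + k) = n := by omega
  rw [log_choose_add, log_choose_add, log_choose_add]
  have l1 := mul_log_sub_le_log_factorial k
  have l2 := mul_log_sub_le_log_factorial u
  have l3 := mul_log_sub_le_log_factorial v
  have l4 := mul_log_sub_le_log_factorial ((v + k) + (u + k))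
  have u1 := log_factorial_le (show v + k ≤ (v + k) + (u + k) by omega) hn
  have u2 := log_factorial_le (show u + k ≤ (v + k) + (u + k) by omega) hn
  rw [derExp_eq]
  set N : ℝ := ((v + k + (u + k) : ℕ) : ℝ) with hN
  have hN' : N = u + v + 2 * k := by rw [hN]; push_cast; ring
  have d1 : ((u : ℝ) + k) / N - 2 * k / N / 2 = u / N := by field_simp; ring
  have d2 : 1 - ((u : ℝ) + k) / N - 2 * k / N / 2 = v / N := by
    field_simp; rw [hN']; ring
  have d4 : 1 - ((u : ℝ) + k) / N = (v + k) / N := by field_simp; rw [hN']; ring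
  rw [d1, d2, d4]
  have e1 := mul_negMulLog_div (x := (u : ℝ)) hn'
  have e2 := mul_negMulLog_div (x := (v : ℝ)) hn'
  have e3 := mul_negMulLog_div (x := (2 * k : ℝ)) hn'
  have e4 := mul_negMulLog_div (x := (v + k : ℝ)) hn'
  have e5 := mul_negMulLog_div (x := (u + k : ℝ)) hn'
  have e6 := mul_log_two_mul (k : ℝ)
  have e7 : N * (2 * k / N * log 2) = 2 * k * log 2 := by field_simp
  have e8 : N * log N = u * log N + v * log N + 2 * k * log N := by
    nth_rewrite 1 [hN']; ring
  push_cast at u1 u2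
  simp only [mul_sub, mul_add]
  rw [e1, e2, e3, e7, mul_left_comm N 2, mul_left_comm N 2, e4, e5]
  linarith

lemma choose_half_le {N j : ℕ} (hj : j ≤ N) (hN : 1 ≤ N) :
    ((N.choose j : ℕ) : ℝ) ≤ exp ((log N + 1) + N * binEntropy (j / N)) := by
  have hn' : (0 : ℝ) < N := by exact_mod_cast hN
  rw [← log_le_iff_le_exp (by exact_mod_cast Nat.choose_pos hj)]
  obtain ⟨i, rfl⟩ := Nat.exists_eq_add_of_le' hj
  rw [log_choose_add, binEntropy_eq_negMulLog_add_negMulLog_one_sub]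
  have l1 := mul_log_sub_le_log_factorial i
  have l2 := mul_log_sub_le_log_factorial j
  have u1 := log_factorial_le (le_refl (i + j)) hN
  set N : ℝ := ((i + j : ℕ) : ℝ) with hN
  have hN' : N = i + j := by rw [hN]; push_cast; ring
  have d : 1 - (j : ℝ) / N = i / N := by field_simp; rw [hN']; ring
  have e8 : N * log N = i * log N + j * log N := by
    nth_rewrite 1 [hN']; ring
  rw [d, mul_add, mul_negMulLog_div hn', mul_negMulLog_div hn']
  linarith

/-- The probability that the matrix `M` maps a uniformly random vector of weight `a` to a vector
of weight `b` (and `0` if `a` exceeds the length). -/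
noncomputable def transProb {n : ℕ} (M : Matrix (Fin n) (Fin n) (ZMod 2)) (a b : ℕ) : ℝ :=
  transCount M a b / n.choose a

lemma transProb_nonneg {n : ℕ} (M : Matrix (Fin n) (Fin n) (ZMod 2)) (a b : ℕ) :
    0 ≤ transProb M a b := by
  unfold transProb; positivity

/-- The relative weight after rounding the weight down to an even number. -/
noncomputable def evenWeight (n a : ℕ) : ℝ := 2 * (a / 2 : ℕ) / n

lemma evenWeight_nonneg (n a : ℕ) : 0 ≤ evenWeight n a := by
  unfold evenWeight; positivity

lemma evenWeight_le (n a : ℕ) : evenWeight n a ≤ a / n := by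
  have : 2 * (a / 2) ≤ a := Nat.mul_div_le a 2
  unfold evenWeight
  gcongr
  exact_mod_cast this

lemma choose_two_mul_half_le {n a : ℕ} (ha : a ≤ n) (hn : 1 ≤ n) :
    n.choose (2 * (a / 2)) ≤ n * n.choose a := by
  rcases Nat.even_or_odd' a with ⟨k, rfl | rfl⟩
  · rw [Nat.mul_div_cancel_left _ two_pos]
    exact Nat.le_mul_of_pos_left _ hn
  · rw [show (2 * k + 1) / 2 = k by omega]
    calc n.choose (2 * k) ≤ n.choose (2 * k) * (n - 2 * k) :=
          Nat.le_mul_of_pos_right _ (by omega)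
      _ = n.choose (2 * k + 1) * (2 * k + 1) := (Nat.choose_succ_right_eq _ _).symm
      _ ≤ n * n.choose (2 * k + 1) := by
          rw [mul_comm]; exact Nat.mul_le_mul_right _ ha

lemma half_le_of_mul_choose_ne_zero {n w a : ℕ}
    (h : (n - w).choose (a / 2) * w.choose (a / 2) ≠ 0) : a / 2 ≤ n - w ∧ a / 2 ≤ w := by
  refine ⟨le_of_not_gt fun h1 => h ?_, le_of_not_gt fun h1 => h ?_⟩
  · rw [Nat.choose_eq_zero_of_lt h1, zero_mul]
  · rw [Nat.choose_eq_zero_of_lt h1, mul_zero]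

lemma evenWeight_le_of_half_le {n w a : ℕ} (hn : 1 ≤ n) (hw : w ≤ n) (h1 : a / 2 ≤ n - w)
    (h2 : a / 2 ≤ w) :
    evenWeight n a ≤ 2 * (w / n) ∧ evenWeight n a ≤ 2 * (1 - w / n) := by
  have hn' : (0 : ℝ) < n := by exact_mod_cast hn
  have h2' : ((a / 2 : ℕ) : ℝ) ≤ w := by exact_mod_cast h2
  have h1' : ((a / 2 : ℕ) : ℝ) + w ≤ n := by exact_mod_cast (by omega : a / 2 + w ≤ n)
  unfold evenWeight
  constructor
  · rw [mul_div_assoc]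
    gcongr
  · rw [mul_div_assoc]
    refine mul_le_mul_of_nonneg_left ?_ two_pos.le
    rw [le_sub_iff_add_le, ← add_div, div_le_one hn']
    exact h1'

lemma exp_log_bound {x y z : ℕ} {e : ℝ} (hx : 0 < x) (hy : 0 < y) (hz : 0 < z)
    (h : log x + log y - log z ≤ e) : (x : ℝ) * y / z ≤ exp e := by
  have hx' : (0 : ℝ) < x := by exact_mod_cast hx
  have hy' : (0 : ℝ) < y := by exact_mod_cast hy
  have hz' : (0 : ℝ) < z := by exact_mod_cast hz
  rw [← log_le_iff_le_exp (by positivity), log_div (by positivity) hz'.ne',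
    log_mul hx'.ne' hy'.ne']
  exact h

/-- Up to a polynomial factor, the transition probabilities of the accumulator are given by the
exponent `accExp`, after rounding the input weight to an even number. -/
lemma IsAccumulatorLike.transProb_le {n : ℕ} {M : Matrix (Fin n) (Fin n) (ZMod 2)}
    (hM : IsAccumulatorLike M) (hn : 1 ≤ n) {a w : ℕ} (ha : a ≤ n) (hw : w ≤ n) :
    transProb M a w = 0 ∨ (evenWeight n a ≤ 2 * (w / n) ∧ evenWeight n a ≤ 2 * (1 - w / n) ∧
      transProb M a w ≤ exp (5 * (log n + 1) + n * accExp (evenWeight n a) (w / n))) := by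
  have hn' : (0 : ℝ) < n := by exact_mod_cast hn
  by_cases h0 : (n - w).choose (a / 2) * w.choose (a / 2) = 0
  · left
    have := hM a w
    rw [h0, Nat.le_zero] at this
    rw [transProb, this, Nat.cast_zero, zero_div]
  · right
    obtain ⟨h1, h2⟩ := half_le_of_mul_choose_ne_zero h0
    obtain ⟨d1, d2⟩ := evenWeight_le_of_half_le hn hw h1 h2
    refine ⟨d1, d2, ?_⟩
    obtain ⟨u, hu⟩ := Nat.exists_eq_add_of_le' h2
    obtain ⟨v, hv⟩ := Nat.exists_eq_add_of_le' h1
    have hwu : ((u : ℝ) + (a / 2 : ℕ)) = w := by exact_mod_cast hu.symm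
    have key := acc_choose_le (u := u) (v := v) (k := a / 2) (n := n) (by omega) hn
    rw [← hu, ← hv, hwu] at key
    replace key := exp_log_bound (Nat.choose_pos h1) (Nat.choose_pos h2)
      (Nat.choose_pos (by omega : 2 * (a / 2) ≤ n)) key
    have hc : (0 : ℝ) < n.choose a := by exact_mod_cast Nat.choose_pos ha
    have hc2 : (0 : ℝ) < n.choose (2 * (a / 2)) := by
      exact_mod_cast Nat.choose_pos (by omega : 2 * (a / 2) ≤ n)
    have hle : ((n.choose (2 * (a / 2)) : ℕ) : ℝ) ≤ n * n.choose a := by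
      exact_mod_cast choose_two_mul_half_le ha hn
    have hT : (transCount M a w : ℝ) ≤ (n - w).choose (a / 2) * w.choose (a / 2) := by
      exact_mod_cast hM a w
    have hln : (n : ℝ) ≤ exp (log n + 1) := by
      rw [exp_add, exp_log hn']
      exact le_mul_of_one_le_right hn'.le (one_le_exp zero_le_one)
    have e : exp (5 * (log n + 1) + n * accExp (evenWeight n a) (w / n)) = exp (log n + 1) *
        exp (4 * (log n + 1) + n * accExp (evenWeight n a) (w / n)) := by
      rw [← exp_add]; ring_nf
    rw [e, transProb]
    calc (transCount M a w : ℝ) / n.choose a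
        ≤ (n - w).choose (a / 2) * w.choose (a / 2) / n.choose a := by gcongr
      _ = n * ((n - w).choose (a / 2) * w.choose (a / 2) / (n * n.choose a)) := by field_simp
      _ ≤ n * ((n - w).choose (a / 2) * w.choose (a / 2) / n.choose (2 * (a / 2))) := by gcongr
      _ ≤ _ := by
        gcongr
        exact key

/-- Up to a polynomial factor, the transition probabilities of the derivative are given by the
exponent `derExp`, after rounding the output weight to an even number. -/
lemma IsDerivativeLike.transProb_le {n : ℕ} {M : Matrix (Fin n) (Fin n) (ZMod 2)}
    (hM : IsDerivativeLike M) (hn : 1 ≤ n) {w a : ℕ} (hw : w ≤ n) :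
    transProb M w a = 0 ∨ (evenWeight n a ≤ 2 * (w / n) ∧ evenWeight n a ≤ 2 * (1 - w / n) ∧
      transProb M w a ≤ exp (5 * (log n + 1) + n * derExp (w / n) (evenWeight n a))) := by
  have hn' : (0 : ℝ) < n := by exact_mod_cast hn
  have hl : 0 ≤ log n := log_nonneg (by exact_mod_cast hn)
  by_cases h0 : (n - w).choose (a / 2) * w.choose (a / 2) = 0
  · left
    have := hM w a
    rw [h0, Nat.le_zero] at this
    rw [transProb, this, Nat.cast_zero, zero_div]
  · right
    obtain ⟨h1, h2⟩ := half_le_of_mul_choose_ne_zero h0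
    obtain ⟨d1, d2⟩ := evenWeight_le_of_half_le hn hw h1 h2
    refine ⟨d1, d2, ?_⟩
    obtain ⟨u, hu⟩ := Nat.exists_eq_add_of_le' h2
    obtain ⟨v, hv⟩ := Nat.exists_eq_add_of_le' h1
    have hwu : ((u : ℝ) + (a / 2 : ℕ)) = w := by exact_mod_cast hu.symm
    have key := der_choose_le (u := u) (v := v) (k := a / 2) (n := n) (by omega) hn
    rw [← hu, ← hv, hwu] at key
    replace key := exp_log_bound (Nat.choose_pos h1) (Nat.choose_pos h2) (Nat.choose_pos hw) key
    have hT : (transCount M w a : ℝ) ≤ (n - w).choose (a / 2) * w.choose (a / 2) := by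
      exact_mod_cast hM w a
    rw [transProb]
    calc (transCount M w a : ℝ) / n.choose w
        ≤ (n - w).choose (a / 2) * w.choose (a / 2) / n.choose w := by gcongr
      _ ≤ _ := key
      _ ≤ _ := by
        rw [exp_le_exp]
        unfold evenWeight
        linarith

end RepeatAccumulate

namespace RepeatAccumulate

open Finset

/-! ### Averaging over the permutations -/

lemma hammingNorm_le_length {n : ℕ} (v : Fin n → ZMod 2) : hammingNorm v ≤ n := by
  simpa using hammingNorm_le_card_fintype (x := v)

lemma eq_one_of_ne_zero : ∀ x : ZMod 2, x ≠ 0 → x = 1 := by decide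

lemma card_hammingNorm_eq (n a : ℕ) :
    #{u : Fin n → ZMod 2 | hammingNorm u = a} = n.choose a := by
  rw [← card_fin n, ← card_powersetCard, card_fin]
  refine card_nbij' (fun u => ({i | u i ≠ 0} : Finset (Fin n)))
    (fun s i => if i ∈ s then 1 else 0) ?_ ?_ ?_ ?_
  · intro u hu
    obtain ⟨-, h⟩ := mem_filter.1 (mem_coe.1 hu)
    exact mem_coe.2 (mem_powersetCard.2 ⟨subset_univ _, h⟩)
  · intro s hs
    obtain ⟨-, h⟩ := mem_powersetCard.1 (mem_coe.1 hs)
    refine mem_coe.2 (mem_filter.2 ⟨mem_univ _, ?_⟩)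
    rw [← h, hammingNorm]
    congr 1
    ext i
    simp
  · intro u _
    funext i
    by_cases h : u i = 0
    · simp [h]
    · simp [eq_one_of_ne_zero _ h]
  · intro s _
    ext i
    simp

lemma exists_perm_of_hammingNorm_eq {n : ℕ} {u v : Fin n → ZMod 2}
    (h : hammingNorm u = hammingNorm v) : ∃ σ : Equiv.Perm (Fin n), u = v ∘ σ := by
  have hc : Fintype.card {i // u i ≠ 0} = Fintype.card {i // v i ≠ 0} := by
    rw [Fintype.card_subtype, Fintype.card_subtype]
    exact h
  let e : {i // u i ≠ 0} ≃ {i // v i ≠ 0} := Fintype.equivOfCardEq hc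
  refine ⟨e.extendSubtype, funext fun i => ?_⟩
  by_cases hi : u i ≠ 0
  · have := e.extendSubtype_mem i hi
    rw [Function.comp_apply, eq_one_of_ne_zero _ hi, eq_one_of_ne_zero _ this]
  · have := e.extendSubtype_not_mem i hi
    rw [Function.comp_apply, not_not.1 hi, not_not.1 this]

/-- A random permutation maps a vector of weight `a` to a uniformly random vector of weight `a`. -/
lemma expect_perm {n : ℕ} (v : Fin n → ZMod 2) (f : (Fin n → ZMod 2) → ℝ) :
    𝔼 σ : Equiv.Perm (Fin n), f (v ∘ σ) =
      (∑ u with hammingNorm u = hammingNorm v, f u) / n.choose (hammingNorm v) := by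
  have hne : (n.choose (hammingNorm v) : ℝ) ≠ 0 := by
    exact_mod_cast (Nat.choose_pos (hammingNorm_le_length v)).ne'
  have hinv : ∀ u, hammingNorm u = hammingNorm v →
      𝔼 σ : Equiv.Perm (Fin n), f (u ∘ σ) = 𝔼 σ : Equiv.Perm (Fin n), f (v ∘ σ) := by
    intro u hu
    obtain ⟨τ, rfl⟩ := exists_perm_of_hammingNorm_eq hu
    exact Fintype.expect_equiv (Equiv.mulLeft τ) _ _ fun σ => rfl
  have h1 : ∑ u with hammingNorm u = hammingNorm v, 𝔼 σ : Equiv.Perm (Fin n), f (u ∘ σ) =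
      n.choose (hammingNorm v) * 𝔼 σ : Equiv.Perm (Fin n), f (v ∘ σ) := by
    rw [sum_congr rfl fun u hu => hinv u (mem_filter.1 hu).2, sum_const, card_hammingNorm_eq,
      nsmul_eq_mul]
  have h2 : ∀ σ : Equiv.Perm (Fin n), ∑ u with hammingNorm u = hammingNorm v, f (u ∘ σ) =
      ∑ u with hammingNorm u = hammingNorm v, f u := by
    intro σ
    rw [sum_filter, sum_filter]
    rw [← (Equiv.arrowCongr σ.symm (Equiv.refl (ZMod 2))).sum_comp
      (fun u => if hammingNorm u = hammingNorm v then f u else 0)]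
    refine sum_congr rfl fun u _ => ?_
    have : Equiv.arrowCongr σ.symm (Equiv.refl (ZMod 2)) u = u ∘ σ := rfl
    rw [this, hammingNorm_comp_equiv]
  rw [← expect_sum_comm, expect_congr rfl fun σ _ => h2 σ, Fintype.expect_const] at h1
  rw [h1, mul_div_cancel_left₀ _ hne]

lemma expect_transition {n : ℕ} (M : Matrix (Fin n) (Fin n) (ZMod 2)) (v : Fin n → ZMod 2)
    (b : ℕ) : 𝔼 σ : Equiv.Perm (Fin n), (if hammingNorm (M *ᵥ (v ∘ σ)) = b then (1 : ℝ) else 0) =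
      transProb M (hammingNorm v) b := by
  rw [expect_perm v fun u => if hammingNorm (M *ᵥ u) = b then (1 : ℝ) else 0, transProb,
    transCount, sum_boole, filter_filter]

/-- The probability that a round, with random permutations before `B` and before `C`, maps a
vector of weight `a` to a vector of weight `b`. -/
noncomputable def roundProb {n : ℕ} (B C : Matrix (Fin n) (Fin n) (ZMod 2)) (a b : ℕ) : ℝ :=
  ∑ w ∈ range (n + 1), transProb B a w * transProb C w b

/-- One round, with the permutations `g`. -/
def roundMap {n : ℕ} (B C : Matrix (Fin n) (Fin n) (ZMod 2))
    (g : Equiv.Perm (Fin n) × Equiv.Perm (Fin n)) (v : Fin n → ZMod 2) : Fin n → ZMod 2 :=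
  C *ᵥ ((B *ᵥ (v ∘ g.1)) ∘ g.2)

lemma expect_prod {α β : Type*} [Fintype α] [Fintype β] (F : α × β → ℝ) :
    𝔼 g, F g = 𝔼 a, 𝔼 b, F (a, b) := by
  rw [← univ_product_univ, expect_product]

lemma expect_round {n : ℕ} (B C : Matrix (Fin n) (Fin n) (ZMod 2)) (v : Fin n → ZMod 2) (b : ℕ) :
    𝔼 g : Equiv.Perm (Fin n) × Equiv.Perm (Fin n),
      (if hammingNorm (roundMap B C g v) = b then (1 : ℝ) else 0) =
      roundProb B C (hammingNorm v) b := by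
  have hin : ∀ σ : Equiv.Perm (Fin n), 𝔼 τ : Equiv.Perm (Fin n),
      (if hammingNorm (roundMap B C (σ, τ) v) = b then (1 : ℝ) else 0) =
      transProb C (hammingNorm (B *ᵥ (v ∘ σ))) b := fun σ => by
    rw [← expect_transition]
    rfl
  rw [expect_prod, expect_congr rfl fun σ _ => hin σ,
    expect_perm v fun u => transProb C (hammingNorm (B *ᵥ u)) b, roundProb, sum_div,
    ← sum_fiberwise_of_maps_to (t := range (n + 1)) (g := fun u => hammingNorm (B *ᵥ u))
      (fun u _ => mem_range.2 (Nat.lt_succ_of_le (hammingNorm_le_length _)))]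
  refine sum_congr rfl fun w _ => ?_
  rw [sum_congr rfl (g := fun _ => transProb C w b / n.choose (hammingNorm v))
    fun u hu => by rw [(mem_filter.1 hu).2], sum_const, filter_filter, nsmul_eq_mul,
    show transProb B (hammingNorm v) w = (transCount B (hammingNorm v) w : ℝ) / _ from rfl,
    transCount]
  ring

lemma generator_mulVec_succ {n m : ℕ} (B C : Matrix (Fin n) (Fin n) (ZMod 2))
    (π : RoundPerms n m) (i : ℕ) (hi : i + 1 ≤ m) (x : Fin (n / 2) → ZMod 2) :
    generator B C π (i + 1) hi *ᵥ x =
      roundMap B C (π ⟨i, hi⟩) (generator B C π i (Nat.le_of_succ_le hi) *ᵥ x) := by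
  rw [generator, roundMap, ← Matrix.mulVec_mulVec, ← Matrix.mulVec_mulVec, ← Matrix.mulVec_mulVec,
    ← Matrix.mulVec_mulVec, Matrix.permMatrix_mulVec, Matrix.permMatrix_mulVec]

lemma generator_congr {n m : ℕ} (B C : Matrix (Fin n) (Fin n) (ZMod 2)) {π π' : RoundPerms n m} :
    ∀ (i : ℕ) (hi : i ≤ m), (∀ j : Fin m, (j : ℕ) < i → π j = π' j) →
      generator B C π i hi = generator B C π' i hi
  | 0, _, _ => rfl
  | i + 1, hi, h => by
    rw [generator, generator, h ⟨i, hi⟩ (Nat.lt_succ_self i),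
      generator_congr B C i _ fun j hj => h j (hj.trans (Nat.lt_succ_self i))]

/-- The expected number of messages whose encoding has weight `a` after `i` rounds. -/
noncomputable def avgCount {n m : ℕ} (B C : Matrix (Fin n) (Fin n) (ZMod 2)) (i : ℕ) (hi : i ≤ m)
    (a : ℕ) : ℝ :=
  𝔼 π : RoundPerms n m, ∑ x, if weightAfter B C π i hi x = a then (1 : ℝ) else 0

lemma expect_mul_left {G : Type*} [Group G] [Fintype G] (h : G) (F : G → ℝ) :
    𝔼 g, F (h * g) = 𝔼 g, F g :=
  Fintype.expect_equiv (Equiv.mulLeft h) _ _ fun g => by rw [Equiv.coe_mulLeft]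

lemma expect_mul_right {G : Type*} [Group G] [Fintype G] (h : G) (F : G → ℝ) :
    𝔼 g, F (g * h) = 𝔼 g, F g :=
  Fintype.expect_equiv (Equiv.mulRight h) _ _ fun g => by rw [Equiv.coe_mulRight]

/-- One coordinate of a random element of a power of a finite group can be multiplied by a further
random element. -/
lemma expect_mulSingle {ι G : Type*} [Fintype ι] [DecidableEq ι] [Group G] [Fintype G] (k : ι)
    (F : (ι → G) → ℝ) : 𝔼 π, F π = 𝔼 π, 𝔼 g, F (π * (Pi.mulSingle k g : ι → G)) := by
  rw [expect_comm, expect_congr rfl fun g _ => expect_mul_right (Pi.mulSingle k g : ι → G) F,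
    Fintype.expect_const]

lemma generator_mul_mulSingle {n m : ℕ} (B C : Matrix (Fin n) (Fin n) (ZMod 2))
    (π : RoundPerms n m) (i : ℕ) (hi : i < m) (g : Equiv.Perm (Fin n) × Equiv.Perm (Fin n)) :
    generator B C (π * Pi.mulSingle (⟨i, hi⟩ : Fin m) g) i hi.le = generator B C π i hi.le :=
  generator_congr B C i _ fun j hj => by
    rw [Pi.mul_apply, Pi.mulSingle_eq_of_ne, mul_one]
    rintro rfl
    exact lt_irrefl _ hj

/-- The permutations of round `i + 1` are independent of the encoding after `i` rounds. -/
lemma expect_joint {n m : ℕ} (B C : Matrix (Fin n) (Fin n) (ZMod 2)) (i : ℕ) (hi : i + 1 ≤ m)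
    (a b : ℕ) :
    𝔼 π : RoundPerms n m, ∑ x,
      (if weightAfter B C π i (Nat.le_of_succ_le hi) x = a ∧ weightAfter B C π (i + 1) hi x = b
        then (1 : ℝ) else 0) =
      avgCount B C i (Nat.le_of_succ_le hi) a * roundProb B C a b := by
  rw [expect_mulSingle (⟨i, hi⟩ : Fin m), avgCount, expect_mul]
  refine expect_congr rfl fun π _ => ?_
  rw [sum_mul, expect_sum_comm]
  refine sum_congr rfl fun x _ => ?_
  simp only [weightAfter, generator_mulVec_succ, generator_mul_mulSingle, Pi.mul_apply,
    Pi.mulSingle_eq_same]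
  by_cases hv : hammingNorm (generator B C π i (Nat.le_of_succ_le hi) *ᵥ x) = a
  · simp only [hv, true_and, if_true, one_mul]
    rw [← hv, ← expect_round]
    exact expect_mul_left (π ⟨i, hi⟩) fun g =>
      if hammingNorm (roundMap B C g (generator B C π i (Nat.le_of_succ_le hi) *ᵥ x)) = b
        then (1 : ℝ) else 0
  · simp only [hv, false_and, if_false, zero_mul, expect_const_zero]

lemma weightAfter_mem_range {n m : ℕ} (B C : Matrix (Fin n) (Fin n) (ZMod 2)) (π : RoundPerms n m)
    (i : ℕ) (hi : i ≤ m) (x : Fin (n / 2) → ZMod 2) :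
    weightAfter B C π i hi x ∈ range (n + 1) :=
  mem_range.2 (Nat.lt_succ_of_le (hammingNorm_le_length _))

lemma avgCount_succ {n m : ℕ} (B C : Matrix (Fin n) (Fin n) (ZMod 2)) (i : ℕ) (hi : i + 1 ≤ m)
    (b : ℕ) : avgCount B C (i + 1) hi b =
      ∑ a ∈ range (n + 1), avgCount B C i (Nat.le_of_succ_le hi) a * roundProb B C a b := by
  rw [← sum_congr rfl fun a _ => expect_joint B C i hi a b, ← expect_sum_comm, avgCount]
  refine expect_congr rfl fun π _ => ?_
  rw [sum_comm]
  refine sum_congr rfl fun x _ => ?_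
  simp only [ite_and]
  rw [sum_ite_eq, if_pos (weightAfter_mem_range ..)]

lemma expectedMiddleLow_succ {n : ℕ} (m : ℕ) (B C : Matrix (Fin n) (Fin n) (ZMod 2)) (h d : ℝ) :
    expectedMiddleLow (m + 1) B C h d =
      ∑ a ∈ range (n + 1), ∑ b ∈ range (n + 1),
        if h ≤ (a : ℝ) ∧ (a : ℝ) ≤ n - h ∧ (b : ℝ) ≤ d then
          avgCount (m := m + 1) B C m (Nat.le_succ m) a * roundProb B C a b else 0 := by
  simp only [← expect_joint B C m le_rfl]
  have e : ∀ a b : ℕ, (if h ≤ (a : ℝ) ∧ (a : ℝ) ≤ n - h ∧ (b : ℝ) ≤ d then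
      𝔼 π : RoundPerms n (m + 1), ∑ x, (if weightAfter B C π m (Nat.le_succ m) x = a ∧
        weightAfter B C π (m + 1) le_rfl x = b then (1 : ℝ) else 0) else 0) =
      𝔼 π : RoundPerms n (m + 1), ∑ x, (if weightAfter B C π m (Nat.le_succ m) x = a then
        if weightAfter B C π (m + 1) le_rfl x = b then
        if h ≤ (a : ℝ) ∧ (a : ℝ) ≤ n - h ∧ (b : ℝ) ≤ d then (1 : ℝ) else 0 else 0 else 0) := by
    intro a b
    by_cases hc : h ≤ (a : ℝ) ∧ (a : ℝ) ≤ n - h ∧ (b : ℝ) ≤ d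
    · simp only [if_pos hc, ite_and]
    · simp only [if_neg hc, ite_self, sum_const_zero, expect_const_zero]
  simp only [e]
  rw [sum_congr rfl fun a _ => (expect_sum_comm _ _ _).symm, ← expect_sum_comm, expectedMiddleLow]
  refine expect_congr rfl fun π _ => ?_
  rw [middleLowCount, ← sum_boole, sum_congr rfl fun a _ => sum_comm, sum_comm]
  refine sum_congr rfl fun x _ => ?_
  have e2 : ∀ a : ℕ, (∑ b ∈ range (n + 1), if weightAfter B C π m (Nat.le_succ m) x = a then
        if weightAfter B C π (m + 1) le_rfl x = b then
        if h ≤ (a : ℝ) ∧ (a : ℝ) ≤ n - h ∧ (b : ℝ) ≤ d then (1 : ℝ) else 0 else 0 else 0) =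
      if weightAfter B C π m (Nat.le_succ m) x = a then
        if h ≤ (a : ℝ) ∧ (a : ℝ) ≤ n - h ∧ (weightAfter B C π (m + 1) le_rfl x : ℝ) ≤ d
        then (1 : ℝ) else 0 else 0 := by
    intro a
    by_cases hc : weightAfter B C π m (Nat.le_succ m) x = a
    · simp only [if_pos hc]
      rw [sum_ite_eq, if_pos (weightAfter_mem_range ..)]
    · simp only [if_neg hc, sum_const_zero]
  rw [sum_congr rfl fun a _ => e2 a, sum_ite_eq, if_pos (weightAfter_mem_range ..)]
  rfl

/-! ### The weights of the repetition code -/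

lemma hammingNorm_repetition {n : ℕ} (hn : Even n) (x : Fin (n / 2) → ZMod 2) :
    hammingNorm (repetition n *ᵥ x) = 2 * hammingNorm x := by
  obtain ⟨N, rfl⟩ := hn.two_dvd
  have hx : ∀ i : Fin (2 * N), (repetition (2 * N) *ᵥ x) i = x ⟨(i : ℕ) / 2, by omega⟩ := by
    intro i
    rw [Matrix.mulVec, dotProduct, sum_eq_single (⟨(i : ℕ) / 2, by omega⟩ : Fin (2 * N / 2))]
    · simp [repetition]
    · intro j _ hj
      have : ¬ (i : ℕ) / 2 = (j : ℕ) := fun h => hj (Fin.ext h.symm)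
      simp [repetition, this]
    · exact fun h => absurd (mem_univ _) h
  rw [hammingNorm, hammingNorm, card_filter, card_filter]
  simp only [hx]
  let e : Fin (2 * N / 2) × Fin 2 ≃ Fin (2 * N) :=
    finProdFinEquiv.trans (finCongr (by omega))
  have he : ∀ p, (e p : ℕ) / 2 = (p.1 : ℕ) := by
    intro p
    have : (e p : ℕ) = p.2 + 2 * p.1 := rfl
    omega
  rw [← e.sum_comp, Fintype.sum_prod_type, mul_sum]
  refine sum_congr rfl fun j _ => ?_
  simp only [he, Fin.sum_univ_two, two_mul, Fin.eta]

lemma avgCount_zero {n m : ℕ} (B C : Matrix (Fin n) (Fin n) (ZMod 2)) (hn : Even n) (a : ℕ) :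
    avgCount (m := m) B C 0 (Nat.zero_le m) a =
      if Even a then ((n / 2).choose (a / 2) : ℝ) else 0 := by
  have h : ∀ π : RoundPerms n m, (∑ x, if weightAfter B C π 0 (Nat.zero_le m) x = a
      then (1 : ℝ) else 0) = if Even a then ((n / 2).choose (a / 2) : ℝ) else 0 := by
    intro π
    rw [sum_boole]
    simp only [weightAfter, generator, hammingNorm_repetition hn]
    split_ifs with ha
    · rw [← card_hammingNorm_eq]
      congr 2
      ext x
      simp only [mem_filter, mem_univ, true_and]
      have := ha.two_dvd
      omega
    · rw [filter_false_of_mem, card_empty, Nat.cast_zero]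
      rintro x - rfl
      exact ha (even_two_mul _)
  rw [avgCount, expect_congr rfl fun π _ => h π, Fintype.expect_const]

end RepeatAccumulate

namespace RepeatAccumulate

open Real Finset

/-! ### Expected weight distributions -/

lemma succ_le_exp {n : ℕ} (hn : 1 ≤ n) : ((n + 1 : ℕ) : ℝ) ≤ exp (log n + 1) := by
  have hn' : (1 : ℝ) ≤ n := by exact_mod_cast hn
  rw [exp_add, exp_log (by linarith)]
  have := add_one_le_exp (1 : ℝ)
  push_cast
  nlinarith

lemma sum_range_le_exp {n : ℕ} (hn : 1 ≤ n) {f : ℕ → ℝ} {K y : ℝ}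
    (h : ∀ a, a ≤ n → f a ≤ exp (K * (log n + 1) + y)) :
    ∑ a ∈ range (n + 1), f a ≤ exp ((K + 1) * (log n + 1) + y) := by
  calc ∑ a ∈ range (n + 1), f a
      ≤ ∑ a ∈ range (n + 1), exp (K * (log n + 1) + y) :=
        sum_le_sum fun a ha => h a (Nat.le_of_lt_succ (mem_range.1 ha))
    _ = ((n + 1 : ℕ) : ℝ) * exp (K * (log n + 1) + y) := by
        rw [sum_const, card_range, nsmul_eq_mul]
    _ ≤ exp (log n + 1) * exp (K * (log n + 1) + y) := by
        gcongr
        exact succ_le_exp hn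
    _ = exp ((K + 1) * (log n + 1) + y) := by
        rw [← exp_add]
        ring_nf

/-- Exponents add up along a round. Each of the two transition bounds costs a factor
`exp (5 (log n + 1))`, and the sum over the weight in the middle a factor `exp (log n + 1)`. -/
lemma mul_roundProb_le {n : ℕ} (hn : 1 ≤ n) {B C : Matrix (Fin n) (Fin n) (ZMod 2)} {a b : ℕ}
    {S K s M : ℝ} (hS : S ≤ exp (K * (log n + 1) + n * s))
    (h : ∀ w, w ≤ n → transProb B a w = 0 ∨ transProb C w b = 0 ∨
      ∃ x y, transProb B a w ≤ exp (5 * (log n + 1) + n * x) ∧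
        transProb C w b ≤ exp (5 * (log n + 1) + n * y) ∧ s + x + y ≤ M) :
    S * roundProb B C a b ≤ exp ((K + 11) * (log n + 1) + n * M) := by
  rw [roundProb, mul_sum, show K + 11 = K + 10 + 1 by ring]
  refine sum_range_le_exp hn fun w hw => ?_
  rcases h w hw with h | h | ⟨x, y, hx, hy, hM⟩
  · rw [h, zero_mul, mul_zero]
    positivity
  · rw [h, mul_zero, mul_zero]
    positivity
  · have hB := transProb_nonneg B a w
    have hC := transProb_nonneg C w b
    calc S * (transProb B a w * transProb C w b)
        ≤ exp (K * (log n + 1) + n * s) *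
          (exp (5 * (log n + 1) + n * x) * exp (5 * (log n + 1) + n * y)) := by gcongr
      _ = exp ((K + 10) * (log n + 1) + n * (s + x + y)) := by
          rw [← exp_add, ← exp_add]
          ring_nf
      _ ≤ _ := by gcongr

lemma mul_accDer_le {n : ℕ} (hn : 1 ≤ n) {B C : Matrix (Fin n) (Fin n) (ZMod 2)}
    (hB : IsAccumulatorLike B) (hC : IsDerivativeLike C) {a b : ℕ} (ha : a ≤ n)
    {S K s M : ℝ} (hS : S ≤ exp (K * (log n + 1) + n * s))
    (h : ∀ ω : ℝ, evenWeight n a ≤ 2 * ω → evenWeight n a ≤ 2 * (1 - ω) → evenWeight n b ≤ 2 * ω →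
      evenWeight n b ≤ 2 * (1 - ω) →
      s + accExp (evenWeight n a) ω + derExp ω (evenWeight n b) ≤ M) :
    S * roundProb B C a b ≤ exp ((K + 11) * (log n + 1) + n * M) := by
  refine mul_roundProb_le hn hS fun w hw => ?_
  rcases hB.transProb_le hn ha hw with h1 | ⟨h1, h2, h3⟩
  · exact Or.inl h1
  rcases hC.transProb_le hn (a := b) hw with h4 | ⟨h4, h5, h6⟩
  · exact Or.inr (Or.inl h4)
  exact Or.inr (Or.inr ⟨_, _, h3, h6, h _ h1 h2 h4 h5⟩)

lemma mul_derAcc_le {n : ℕ} (hn : 1 ≤ n) {B C : Matrix (Fin n) (Fin n) (ZMod 2)}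
    (hB : IsDerivativeLike B) (hC : IsAccumulatorLike C) {a b : ℕ} (ha : a ≤ n) (hb : b ≤ n)
    {S K s M : ℝ} (hS : S ≤ exp (K * (log n + 1) + n * s))
    (h : ∀ ω : ℝ, 0 ≤ ω → ω ≤ 2 * ((a : ℝ) / n) → ω ≤ 2 * (1 - (a : ℝ) / n) →
      ω ≤ 2 * ((b : ℝ) / n) → ω ≤ 2 * (1 - (b : ℝ) / n) →
      s + derExp (a / n) ω + accExp ω (b / n) ≤ M) :
    S * roundProb B C a b ≤ exp ((K + 11) * (log n + 1) + n * M) := by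
  refine mul_roundProb_le hn hS fun w hw => ?_
  rcases hB.transProb_le hn (a := w) ha with h1 | ⟨h1, h2, h3⟩
  · exact Or.inl h1
  rcases hC.transProb_le hn hw hb with h4 | ⟨h4, h5, h6⟩
  · exact Or.inr (Or.inl h4)
  exact Or.inr (Or.inr ⟨_, _, h3, h6, h _ (evenWeight_nonneg n w) h1 h2 h4 h5⟩)

lemma avgCount_zero_le {n m : ℕ} (hn : 1 ≤ n) (he : Even n)
    (B C : Matrix (Fin n) (Fin n) (ZMod 2)) {a : ℕ} (ha : a ≤ n) :
    avgCount (m := m) B C 0 (Nat.zero_le m) a = 0 ∨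
      (evenWeight n a = a / n ∧ avgCount (m := m) B C 0 (Nat.zero_le m) a ≤
        exp (1 * (log n + 1) + n * shape 0 (evenWeight n a))) := by
  rw [avgCount_zero B C he]
  split_ifs with hea
  · right
    obtain ⟨N, rfl⟩ := he.two_dvd
    obtain ⟨j, rfl⟩ := hea.two_dvd
    have hN : 1 ≤ N := by omega
    have hN' : (0 : ℝ) < N := by exact_mod_cast hN
    have e : evenWeight (2 * N) (2 * j) = j / N := by
      rw [evenWeight, Nat.mul_div_cancel_left _ two_pos]
      push_cast
      field_simp
    rw [e, Nat.mul_div_cancel_left _ two_pos, Nat.mul_div_cancel_left _ two_pos, shape_zero]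
    refine ⟨by push_cast; field_simp, (choose_half_le (by omega) hN).trans ?_⟩
    rw [exp_le_exp]
    have : log (N : ℝ) ≤ log ((2 * N : ℕ) : ℝ) :=
      log_le_log hN' (by push_cast; linarith)
    push_cast at *
    linarith
  · exact Or.inl rfl

/-- The expected weight distributions of the codes that accumulate first are bounded, up to a
polynomial factor, by the spectral shape; rounding weights down to even numbers before applying
the shape matches the rounding in the transition bounds of both kinds of matrices. -/
lemma avgCount_accDer_le {n m : ℕ} (hn : 1 ≤ n) (he : Even n)
    {B C : Matrix (Fin n) (Fin n) (ZMod 2)} (hB : IsAccumulatorLike B) (hC : IsDerivativeLike C) :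
    ∀ (i : ℕ) (hi : i ≤ m) (a : ℕ), a ≤ n → avgCount B C i hi a ≤
      exp ((12 * i + 1) * (log n + 1) + n * shape i (evenWeight n a))
  | 0, hi, a, ha => by
    rcases avgCount_zero_le (m := m) hn he B C ha with h | ⟨-, h⟩
    · rw [h]
      positivity
    · simpa using h
  | i + 1, hi, b, hb => by
    rw [avgCount_succ]
    have e : (12 * ((i + 1 : ℕ) : ℝ) + 1) = (12 * i + 1) + 11 + 1 := by push_cast; ring
    rw [e]
    refine sum_range_le_exp hn fun a ha => ?_
    refine mul_accDer_le hn hB hC ha (avgCount_accDer_le hn he hB hC i _ a ha)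
      fun ω h1 h2 h3 h4 => ?_
    have e1 := le_shape_succ (m := i) (evenWeight_nonneg n a) h1 h2
    have e2 := shape_add_derExp_le (m := i + 1) (evenWeight_nonneg n b) h3 h4
    linarith

/-- The expected weight distributions of the codes that differentiate first are bounded, up to a
polynomial factor, by the spectral shape. Here the rounding of weights only affects the weight
in the middle of a round. -/
lemma avgCount_derAcc_le {n m : ℕ} (hn : 1 ≤ n) (he : Even n)
    {B C : Matrix (Fin n) (Fin n) (ZMod 2)} (hB : IsDerivativeLike B) (hC : IsAccumulatorLike C) :
    ∀ (i : ℕ) (hi : i ≤ m) (a : ℕ), a ≤ n → avgCount B C i hi a ≤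
      exp ((12 * i + 1) * (log n + 1) + n * shape i (a / n))
  | 0, hi, a, ha => by
    rcases avgCount_zero_le (m := m) hn he B C ha with h | ⟨h', h⟩
    · rw [h]
      positivity
    · rw [h'] at h
      simpa using h
  | i + 1, hi, b, hb => by
    rw [avgCount_succ]
    have e : (12 * ((i + 1 : ℕ) : ℝ) + 1) = (12 * i + 1) + 11 + 1 := by push_cast; ring
    rw [e]
    refine sum_range_le_exp hn fun a ha => ?_
    refine mul_derAcc_le hn hB hC ha hb (avgCount_derAcc_le hn he hB hC i _ a ha)
      fun ω h0 h1 h2 h3 h4 => ?_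
    have e1 := shape_add_derExp_le (m := i) h0 h1 h2
    have e2 := le_shape_succ (m := i) h0 h3 h4
    linarith

/-! ### The expected number of messages of low final weight -/

lemma expectedMiddleLow_le {n m : ℕ} (hn : 1 ≤ n) {B C : Matrix (Fin n) (Fin n) (ZMod 2)}
    {h d K y : ℝ} (H : ∀ a b : ℕ, a ≤ n → b ≤ n → h ≤ a → (a : ℝ) ≤ n - h → (b : ℝ) ≤ d →
      avgCount (m := m + 1) B C m (Nat.le_succ m) a * roundProb B C a b ≤
        exp (K * (log n + 1) + y)) :
    expectedMiddleLow (m + 1) B C h d ≤ exp ((K + 1 + 1) * (log n + 1) + y) := by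
  rw [expectedMiddleLow_succ]
  refine sum_range_le_exp hn fun a ha => sum_range_le_exp hn fun b hb => ?_
  split_ifs with hc
  · exact H a b ha hb hc.1 hc.2.1 hc.2.2
  · positivity

lemma expectedMiddleLow_of_neg {n m : ℕ} {B C : Matrix (Fin n) (Fin n) (ZMod 2)} {h d : ℝ}
    (hd : d < 0) : expectedMiddleLow (m + 1) B C h d = 0 := by
  rw [expectedMiddleLow_succ]
  refine sum_eq_zero fun a _ => sum_eq_zero fun b _ => if_neg ?_
  rintro ⟨-, -, h3⟩
  have : (0 : ℝ) ≤ b := by positivity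
  linarith

/-- A factor `exp (-c log² n)` outweighs any polynomial. -/
lemma exists_exp_le_rpow (K : ℝ) (hK : 0 ≤ K) {c : ℝ} (hc : 0 < c) :
    ∃ c' : ℝ, 0 < c' ∧ ∀ᶠ n : ℕ in atTop,
      exp (K * (log n + 1) + -(c * (threshold n - 1))) ≤ (n : ℝ) ^ (-(c' * logb 2 n)) := by
  have hl : 0 < log 2 := log_pos one_lt_two
  have hl1 : log 2 ≤ 1 := by linarith [log_two_lt_d9]
  refine ⟨c / (2 * log 2), by positivity, ?_⟩
  have ht : Tendsto (fun n : ℕ => logb 2 (n : ℝ)) atTop atTop :=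
    (tendsto_logb_atTop one_lt_two).comp tendsto_natCast_atTop_atTop
  filter_upwards [ht.eventually_ge_atTop 1, ht.eventually_ge_atTop (2 * (2 * K + c) / c),
    eventually_ge_atTop 1] with n h1 h2 hn
  have hn' : (0 : ℝ) < n := by exact_mod_cast hn
  rw [rpow_def_of_pos hn', exp_le_exp, threshold]
  have e : log n = logb 2 n * log 2 := by rw [logb, div_mul_cancel₀ _ hl.ne']
  rw [e]
  set L := logb 2 (n : ℝ)
  have e2 : L * log 2 * -(c / (2 * log 2) * L) = -(c / 2 * L ^ 2) := by field_simp
  rw [e2]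
  rw [div_le_iff₀ hc] at h2
  have h3 : K * (L * log 2 + 1) ≤ K * (L * 1 + L) := by gcongr
  have h4 : c ≤ c * L := le_mul_of_one_le_right hc.le h1
  nlinarith

theorem exists_accDer_expectation_le (ε : ℝ) (hε : 0 < ε) (m : ℕ) :
    ∃ c : ℝ, 0 < c ∧ ∀ᶠ n : ℕ in atTop, Even n →
      ∀ B C : Matrix (Fin n) (Fin n) (ZMod 2), IsAccumulatorLike B → IsDerivativeLike C →
        expectedMiddleLow (m + 1) B C (threshold n) ((delta (m + 1) - ε) * n)
          ≤ (n : ℝ) ^ (-(c * logb 2 n)) := by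
  rcases lt_or_ge (delta (m + 1) - ε) 0 with hd | hd
  · refine ⟨1, one_pos, (eventually_ge_atTop 1).mono fun n hn _ B C _ _ => ?_⟩
    have hn' : (0 : ℝ) < n := by exact_mod_cast hn
    rw [expectedMiddleLow_of_neg (mul_neg_of_neg_of_pos hd hn')]
    positivity
  · obtain ⟨c, hc, H⟩ := exists_accDer_bound (m := m) hd (by linarith)
    obtain ⟨c', hc', H'⟩ := exists_exp_le_rpow (12 * m + 1 + 11 + 1 + 1) (by positivity) hc
    refine ⟨c', hc', ?_⟩
    filter_upwards [H', eventually_ge_atTop 1] with n h1 hn he B C hB hC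
    have hn' : (0 : ℝ) < n := by exact_mod_cast hn
    refine le_trans (expectedMiddleLow_le hn fun a b ha hb ha1 _ hb1 => ?_) h1
    refine (mul_accDer_le hn hB hC ha (avgCount_accDer_le hn he hB hC m _ a ha)
      (M := -(c * evenWeight n a)) fun ω d1 d2 d3 d4 => H _ _ _ (evenWeight_nonneg n a) d1 d2
        (evenWeight_nonneg n b) d3 d4 ((evenWeight_le n b).trans ?_)).trans ?_
    · rwa [div_le_iff₀ hn']
    · rw [exp_le_exp]
      have e : n * -(c * evenWeight n a) = -(c * (2 * (a / 2 : ℕ))) := by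
        rw [evenWeight]
        field_simp
      have ha2 : (a : ℝ) ≤ 2 * (a / 2 : ℕ) + 1 := by exact_mod_cast (by omega)
      rw [e]
      gcongr
      linarith

theorem exists_derAcc_expectation_le (ε : ℝ) (hε : 0 < ε) (m : ℕ) :
    ∃ c : ℝ, 0 < c ∧ ∀ᶠ n : ℕ in atTop, Even n →
      ∀ B C : Matrix (Fin n) (Fin n) (ZMod 2), IsDerivativeLike B → IsAccumulatorLike C →
        expectedMiddleLow (m + 1) B C (threshold n) ((delta (m + 1) - ε) * n)
          ≤ (n : ℝ) ^ (-(c * logb 2 n)) := by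
  rcases lt_or_ge (delta (m + 1) - ε) 0 with hd | hd
  · refine ⟨1, one_pos, (eventually_ge_atTop 1).mono fun n hn _ B C _ _ => ?_⟩
    have hn' : (0 : ℝ) < n := by exact_mod_cast hn
    rw [expectedMiddleLow_of_neg (mul_neg_of_neg_of_pos hd hn')]
    positivity
  · obtain ⟨c, hc, H⟩ := exists_derAcc_bound (m := m) hd (by linarith)
    obtain ⟨c', hc', H'⟩ := exists_exp_le_rpow (12 * m + 1 + 11 + 1 + 1) (by positivity) hc
    refine ⟨c', hc', ?_⟩
    filter_upwards [H', eventually_ge_atTop 1] with n h1 hn he B C hB hC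
    have hn' : (0 : ℝ) < n := by exact_mod_cast hn
    refine le_trans (expectedMiddleLow_le hn fun a b ha hb ha1 ha2 hb1 => ?_) h1
    refine (mul_derAcc_le hn hB hC ha hb (avgCount_derAcc_le hn he hB hC m _ a ha)
      (M := -(c * min ((a : ℝ) / n) (1 - (a : ℝ) / n))) fun ω d0 d1 d2 d3 _ => H _ _ _ d0 d1 d2 d3 ?_).trans ?_
    · rwa [div_le_iff₀ hn']
    · rw [exp_le_exp]
      have e : threshold n / n ≤ min ((a : ℝ) / n) (1 - a / n) := by
        refine le_min (by gcongr) ?_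
        rw [le_sub_iff_add_le, ← add_div, div_le_one hn']
        linarith
      rw [div_le_iff₀ hn'] at e
      have := mul_le_mul_of_nonneg_left e hc.le
      linarith

end RepeatAccumulate

open RepeatAccumulate
theorem theorem4p7 (ε : ℝ) (hε : 0 < ε) (m : ℕ) (hm : 1 ≤ m) :
    ∃ c : ℝ, 0 < c ∧ ∀ᶠ n : ℕ in atTop, Even n →
      expectedMiddleLow m (accumulator n) (derivative n) (threshold n) ((delta m - ε) * n)
          ≤ (n : ℝ) ^ (-(c * Real.logb 2 n)) ∧
      expectedMiddleLow m (derivative n) (accumulator n) (threshold n) ((delta m - ε) * n)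
          ≤ (n : ℝ) ^ (-(c * Real.logb 2 n)) ∧
      expectedMiddleLow m (accumulator n)ᵀ (derivative n)ᵀ (threshold n) ((delta m - ε) * n)
          ≤ (n : ℝ) ^ (-(c * Real.logb 2 n)) ∧
      expectedMiddleLow m (derivative n)ᵀ (accumulator n)ᵀ (threshold n) ((delta m - ε) * n)
          ≤ (n : ℝ) ^ (-(c * Real.logb 2 n)) := by
  obtain ⟨m, rfl⟩ := Nat.exists_eq_add_of_le' hm
  obtain ⟨c₁, hc₁, H₁⟩ := exists_accDer_expectation_le ε hε m
  obtain ⟨c₂, hc₂, H₂⟩ := exists_derAcc_expectation_le ε hε m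
  refine ⟨min c₁ c₂, lt_min hc₁ hc₂, ?_⟩
  filter_upwards [H₁, H₂, eventually_ge_atTop 1] with n h₁ h₂ hn he
  have hn' : (1 : ℝ) ≤ n := by exact_mod_cast hn
  have hL : 0 ≤ Real.logb 2 n := Real.logb_nonneg one_lt_two hn'
  have m₁ : (n : ℝ) ^ (-(c₁ * Real.logb 2 n)) ≤ (n : ℝ) ^ (-(min c₁ c₂ * Real.logb 2 n)) :=
    Real.rpow_le_rpow_of_exponent_le hn'
      (neg_le_neg (mul_le_mul_of_nonneg_right (min_le_left _ _) hL))
  have m₂ : (n : ℝ) ^ (-(c₂ * Real.logb 2 n)) ≤ (n : ℝ) ^ (-(min c₁ c₂ * Real.logb 2 n)) :=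
    Real.rpow_le_rpow_of_exponent_le hn'
      (neg_le_neg (mul_le_mul_of_nonneg_right (min_le_right _ _) hL))
  have hA := isAccumulatorLike_accumulator n
  have hD := isDerivativeLike_derivative n
  have hA' := isAccumulatorLike_transpose n
  have hD' := isDerivativeLike_transpose n
  exact ⟨(h₁ he _ _ hA hD).trans m₁, (h₂ he _ _ hD hA).trans m₂, (h₁ he _ _ hA' hD').trans m₁,
    (h₂ he _ _ hD' hA').trans m₂⟩
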